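/- **Theorem 4.1.** Let $X_1, X_2, \dots$ be real-valued random variables with common distribution $F$, and write $\overline F(x) = P(X_1 > x)$. Suppose $F$ is heavy-tailed, i.e. $E e^{\alpha X_1} = \infty$ for every $\alpha > 0$. Let $\tau$ be a random variable with values in $\{0,1,2,\dots\}$, independent of the sequence $(X_k)_{k\ge 1}$, with $E z^{\tau} < \infty$ for some $z > 1$, and let $S_\tau = \sum_{k=1}^{\tau} X_k$ (with $S_\tau = 0$ if $\tau=0$). Assume the following two conditions on the dependence of the $X_k$. * (H3) There are positive constants $x_0$ and $c_0$ such that $$P(X_i > x \mid X_j = x_j,\ j \in J) \le c_0\, \overline F(x)$$ for all $i \ge 1$, all non-empty finite sets $J \subset \{1,2,\dots\}\setminus\{i\}$, all $x > x_0$, and almost all values $(x_j)_{j\in J}$ (with respect to the law of $(X_j)_{j\in J}$) with $x_j > x_0$ for every $j \in J$. * (H2) For all $i \neq j$, $\ P(|X_i| > x_i \mid X_j > x_j) \to 0$ as $\min(x_i, x_j) \to \infty$. If $F$ is long-tailed ($F\in\mathcal L$), i.e. $\lim_{x\to\infty} \overline F(x+y)/\overline F(x) = 1$ for every real $y$, then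 $$\liminf_{x\to\infty} \frac{P(S_\tau > x)}{\overline F(x)} = E\tau .$$ If $F$ is subexponential ($F\in\mathcal S$), i.e. the distribution $F^+$ of $\max(X_1,0)$ satisfies $\overline{F^+ * F^+}(x)/\overline{F^+}(x) \to 2$ as $x\to\infty$, then $$\lim_{x\to\infty} \frac{P(S_\tau > x)}{\overline F(x)} = E\tau .$$ -/

import Mathlib

open MeasureTheory ProbabilityTheory Filter Topology Set
open scoped ENNReal

noncomputable section

namespace RandomSum

/-- The tail `x ↦ F((x, ∞))` of a distribution `F` on `ℝ`. -/
def tail (F : Measure ℝ) (x : ℝ) : ℝ≥0∞ := F (Ioi x)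

/-- `F` is heavy tailed (to the right): all its positive exponential moments are infinite. -/
def HeavyTailed (F : Measure ℝ) : Prop :=
  ∀ α : ℝ, 0 < α → ∫⁻ x, ENNReal.ofReal (Real.exp (α * x)) ∂F = ∞

/-- The class `𝓛` of long-tailed distributions. -/
def LongTailed (F : Measure ℝ) : Prop :=
  ∀ y : ℝ, Tendsto (fun x => tail F (x + y) / tail F x) atTop (𝓝 1)

/-- The distribution of `max X 0` when `X` has distribution `F`; its distribution function is
`x ↦ F(x) 1(x ≥ 0)`. -/
def posPart (F : Measure ℝ) : Measure ℝ := F.map (fun x => max x 0)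

/-- The class `𝓢` of subexponential distributions on `ℝ`: the tail of the two-fold convolution of
`F⁺` is asymptotically twice the tail of `F⁺`. -/
def Subexponential (F : Measure ℝ) : Prop :=
  Tendsto (fun x => tail ((posPart F).conv (posPart F)) x / tail (posPart F) x) atTop (𝓝 2)

variable {Ω : Type*} [MeasurableSpace Ω]

/-- Pairwise asymptotic independence:
`P(|X_i| > x_i | X_j > x_j) → 0` as `min x_i x_j → ∞`, for all `i ≠ j`. -/
def PairwiseAsympIndep (P : Measure Ω) (X : ℕ → Ω → ℝ) : Prop :=
  ∀ i j : ℕ, i ≠ j →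
    Tendsto (fun q : ℝ × ℝ => (ProbabilityTheory.cond P {ω | q.2 < X j ω}) {ω | q.1 < |X i ω|})
      (atTop ×ˢ atTop) (𝓝 0)

/-- There are positive constants `x₀`, `c₀` with
`P(X_i > x | X_j = y_j, j ∈ J) ≤ c₀ P(X_i > x)` for every index `i`, every non-empty finite set `J`
of other indices, every `x > x₀` and all possible values `y_j > x₀`. The conditional probability is
the regular conditional distribution of `X_i` given `(X_j)_{j ∈ J}`, which is determined up to null
sets of the law of `(X_j)_{j ∈ J}`. -/
def CondTailBound (P : Measure Ω) [IsFiniteMeasure P] (X : ℕ → Ω → ℝ) : Prop :=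
  ∃ x₀ c₀ : ℝ, 0 < x₀ ∧ 0 < c₀ ∧
    ∀ (i : ℕ) (J : Finset ℕ), J.Nonempty → i ∉ J → ∀ x : ℝ, x₀ < x →
      ∀ᵐ y ∂(P.map (fun ω (j : J) => X j ω)), (∀ j : J, x₀ < y j) →
        condDistrib (X i) (fun ω (j : J) => X j ω) P y (Ioi x)
          ≤ ENNReal.ofReal c₀ * P {ω | x < X i ω}

/-- The random sum of the first `τ` terms of the sequence, which is indexed from `0`. -/
def randomSum (X : ℕ → Ω → ℝ) (τ : Ω → ℕ) (ω : Ω) : ℝ :=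
  ∑ k ∈ Finset.range (τ ω), X k ω

end RandomSum

end

/-!
The proof rests on the principle of one big jump: beyond a high level, a sum of terms is large
because a single term is.

The lower bound `E τ ≤ liminf` uses long tails and pairwise asymptotic independence only. For
fixed `n`, the sum of `n` terms exceeds `x` as soon as one term exceeds `x + n L` and the others
stay in `[-L, L]`; these `n` events are disjoint (`card_mul_tail_le`). Dominated convergence for
truncated ratios then averages over `τ` (`lintegral_le_liminf`).

For the upper bounds, the conditional tail bound says that, on the event that all terms with
indices in a finite set `J` exceed a high level `b`, each term but one may be replaced by an
independent copy at the cost of a constant factor `c` (`lintegral_le_of_condTailBoundWith`). The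
sum of `n` terms is decomposed according to the set `J` of the indices of the terms exceeding `b`;
the singletons give the main term `n`, and a set `J` comes with a factor `ε ^ (|J| - 1)` with `ε`
small.

* If `F` is subexponential, `b` can be chosen such that the restriction `G` of `F` to `(b, ∞)`
  satisfies `(G ∗ G)(x, ∞) ≤ δ G(x, ∞)` for all `x` (`Subexponential.exists_forall_le`). Induction
  on `J` gives the factor `(c δ) ^ (|J| - 1)` (`measure_sum_gt_le`), hence both the upper limit
  `n` for fixed `n` and a Kesten-type bound (`exists_forall_measure_sum_gt_le`) whose rate lies
  below the radius given by the exponential moment of `τ`. Dominated convergence over `τ` finishes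
  the proof.
* If `F` is merely heavy-tailed, the lower limit is bounded through the moments of
  `g x = exp (α min(x⁺, t)) - 1`. As `α → 0` the truncation `t` can be chosen such that the moment `d` of `g`
  under `F` stays of a fixed small order `δ` (`exists_truncExp_level`), while the part of it
  coming from any bounded set becomes negligible. Expanding products over `J`, the moment of `g`
  at the random sum is at most `d E τ` to first order in `d` (`lintegral_truncExp_sum_le`). A tail ratio
  that stays above some `K > E τ` would make it at least about `K d` (`liminf_le_lintegral`).
-/

open MeasureTheory ProbabilityTheory Filter Topology Set
open scoped ENNReal

namespace RandomSum

/-! ### Comparison of tails and a sum over index sets -/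

/-- Comparing the tails beyond `b` compares all upper sets beyond `b`: such a set is an open or a
closed half-line, and a closed one is a decreasing limit of open ones. -/
lemma measure_le_of_isUpperSet {μ ν : Measure ℝ} [IsFiniteMeasure ν] {b : ℝ}
    (h : ∀ t, b ≤ t → μ (Ioi t) ≤ ν (Ioi t)) {U : Set ℝ} (hU : IsUpperSet U)
    (hb : U ⊆ Ioi b) : μ U ≤ ν U := by
  rcases U.eq_empty_or_nonempty with rfl | hne
  · simp
  have hbdd : BddBelow U := ⟨b, fun x hx => (hb hx).le⟩
  have hmem : ∀ x, sInf U < x → x ∈ U := fun x hx => by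
    obtain ⟨y, hy, hyx⟩ := exists_lt_of_csInf_lt hne hx
    exact hU hyx.le hy
  by_cases ha : sInf U ∈ U
  · have hUI : U = Ici (sInf U) :=
      Subset.antisymm (fun x hx => csInf_le hbdd hx) (fun x hx => hU hx ha)
    obtain ⟨u, hu, hub, hut⟩ := exists_seq_strictMono_tendsto' (show b < sInf U from hb ha)
    have hI : (⋂ n, Ioi (u n)) = U := by
      rw [hUI]
      ext x
      simp only [mem_iInter, mem_Ioi, mem_Ici]
      exact ⟨fun hx => le_of_tendsto' hut fun n => (hx n).le,
        fun hx n => (hub n).2.trans_le hx⟩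
    have hlim : Tendsto (fun n => ν (Ioi (u n))) atTop (𝓝 (ν U)) := by
      rw [← hI]
      exact tendsto_measure_iInter_atTop (fun n => measurableSet_Ioi.nullMeasurableSet)
        (fun m n hmn => Ioi_subset_Ioi (hu.monotone hmn)) ⟨0, measure_ne_top _ _⟩
    refine ge_of_tendsto' hlim fun n => (measure_mono ?_).trans (h _ (hub n).1.le)
    rw [← hI]
    exact iInter_subset _ n
  · have hUI : U = Ioi (sInf U) := by
      refine Subset.antisymm (fun x hx => lt_of_le_of_ne (csInf_le hbdd hx) ?_) hmem
      rintro rfl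
      exact ha hx
    rw [hUI]
    exact h _ (le_csInf hne fun x hx => (hb hx).le)

/-- Stochastic domination beyond `b`, for measures whose total masses may differ: it passes to
integrals of monotone functions that vanish up to `b`, by the layer-cake formula. -/
lemma lintegral_le_of_tail_le {μ ν : Measure ℝ} [IsFiniteMeasure ν] {b : ℝ}
    (h : ∀ t, b ≤ t → μ (Ioi t) ≤ ν (Ioi t)) {f : ℝ → ℝ≥0∞} (hf : Monotone f)
    (hb : ∀ x ≤ b, f x = 0) (htop : ∀ x, f x ≠ ∞) : ∫⁻ x, f x ∂μ ≤ ∫⁻ x, f x ∂ν := by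
  have hm : Measurable fun x => (f x).toReal := hf.measurable.ennreal_toReal
  have key : ∀ ρ : Measure ℝ, ∫⁻ x, f x ∂ρ = ∫⁻ s in Ioi 0, ρ {x | s < (f x).toReal} := fun ρ => by
    rw [← lintegral_eq_lintegral_meas_lt ρ (.of_forall fun x => ENNReal.toReal_nonneg)
      hm.aemeasurable]
    simp [ENNReal.ofReal_toReal, htop]
  rw [key, key]
  refine setLIntegral_mono' measurableSet_Ioi fun s hs =>
    measure_le_of_isUpperSet h (fun x y hxy hx => ?_) fun x hx => ?_
  · exact lt_of_lt_of_le hx (ENNReal.toReal_mono (htop y) (hf hxy))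
  · by_contra hxb
    simp only [mem_ofPred_eq, hb x (not_lt.1 hxb), ENNReal.toReal_zero] at hx
    exact lt_asymm hx hs

/-- The weight `ε ^ (|J| - 1)` of an index set, summed over the nonempty subsets; the sum is
`((1 + ε) ^ |s| - 1) / ε`, and the bound keeps the exact first-order coefficient `|s|`. -/
lemma sum_powerset_pow_card_sub_one_le {ι : Type*} [DecidableEq ι] (s : Finset ι) (ε : ℝ≥0∞) :
    ∑ J ∈ s.powerset, (if J.Nonempty then ε ^ (J.card - 1) else 0)
      ≤ s.card * (1 + ε) ^ s.card := by
  induction s using Finset.induction_on with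
  | empty => simp
  | insert a s ha ih =>
    have h1 : ∑ J ∈ s.powerset, (if (insert a J).Nonempty then ε ^ ((insert a J).card - 1) else 0)
        = (1 + ε) ^ s.card := by
      rw [add_comm, ← Finset.sum_pow_mul_eq_add_pow]
      refine Finset.sum_congr rfl fun J hJ => ?_
      rw [Finset.card_insert_of_notMem fun h => ha (Finset.mem_powerset.1 hJ h)]
      simp
    rw [Finset.sum_powerset_insert ha, h1, Finset.card_insert_of_notMem ha]
    have h2 : (1 + ε) ^ s.card ≤ (1 + ε) ^ (s.card + 1) :=
      pow_le_pow_right₀ le_self_add (Nat.le_succ _)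
    calc _ ≤ s.card * (1 + ε) ^ (s.card + 1) + (1 + ε) ^ (s.card + 1) := by
          gcongr
          exact ih.trans (by gcongr)
      _ = _ := by push_cast; ring

variable {Ω : Type*} [MeasurableSpace Ω]

/-! ### Consequences of the conditional tail bound -/

/-- `CondTailBound` with its threshold `b` and its constant `c` exposed: given the values `y_j > b`
of the other variables, the conditional tail of `X i` beyond `b` is at most `c` times its
unconditional tail. The constant is taken in `ℝ≥0∞`. -/
def CondTailBoundWith (P : Measure Ω) [IsFiniteMeasure P] (X : ℕ → Ω → ℝ) (b : ℝ) (c : ℝ≥0∞) :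
    Prop :=
  ∀ (i : ℕ) (J : Finset ℕ), J.Nonempty → i ∉ J → ∀ x : ℝ, b < x →
    ∀ᵐ y ∂(P.map (fun ω (j : J) => X j ω)), (∀ j : J, b < y j) →
      condDistrib (X i) (fun ω (j : J) => X j ω) P y (Ioi x) ≤ c * P {ω | x < X i ω}

lemma CondTailBoundWith.mono {P : Measure Ω} [IsFiniteMeasure P] {X : ℕ → Ω → ℝ} {b b' : ℝ}
    {c : ℝ≥0∞} (h : CondTailBoundWith P X b c) (hb : b ≤ b') : CondTailBoundWith P X b' c := by
  intro i J hJ hi x hx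
  filter_upwards [h i J hJ hi x (hb.trans_lt hx)] with y hy hyb
  exact hy fun j => hb.trans_lt (hyb j)

/-- The form in which the conditional tail bound is used: inside the expectation of a function that
is monotone in `X i` and vanishes unless all its variables exceed `b`, the variable `X i` may be
replaced by an independent copy, at the cost of the factor `c`. -/
lemma lintegral_le_of_condTailBoundWith {P : Measure Ω} [IsFiniteMeasure P] {F : Measure ℝ}
    {X : ℕ → Ω → ℝ} {b : ℝ} {c : ℝ≥0∞} (hX : ∀ k, Measurable (X k)) (hF : ∀ k, P.map (X k) = F)
    (hc : c ≠ ∞) (h : CondTailBoundWith P X b c) {i : ℕ} {J : Finset ℕ} (hJ : J.Nonempty)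
    (hi : i ∉ J) {f : (J → ℝ) → ℝ → ℝ≥0∞} (hf : Measurable (Function.uncurry f))
    (hmono : ∀ y, Monotone (f y)) (hb : ∀ y x, x ≤ b → f y x = 0)
    (hyb : ∀ y x, ¬ (∀ j, b < y j) → f y x = 0) (htop : ∀ y x, f y x ≠ ∞) :
    ∫⁻ ω, f (fun j => X j ω) (X i ω) ∂P ≤ c * ∫⁻ ω, ∫⁻ x, f (fun j => X j ω) x ∂F ∂P := by
  have hFin : IsFiniteMeasure F := by rw [← hF 0]; infer_instance
  have hXJ : Measurable fun ω (j : J) => X j ω := measurable_pi_lambda _ fun j => hX j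
  have htail : ∀ x, P {ω | x < X i ω} = F (Ioi x) := fun x => by
    rw [← hF i, Measure.map_apply (hX i) measurableSet_Ioi]; rfl
  have hae : ∀ᵐ y ∂(P.map (fun ω (j : J) => X j ω)), ∀ q : ℚ, b < q → (∀ j : J, b < y j) →
      condDistrib (X i) (fun ω (j : J) => X j ω) P y (Ioi (q : ℝ)) ≤ c * F (Ioi (q : ℝ)) := by
    rw [ae_all_iff]
    intro q
    by_cases hq : b < q
    · filter_upwards [h i J hJ hi q hq] with y hy _ hyj
      rw [← htail]
      exact hy hyj
    · exact .of_forall fun y hq' => absurd hq' hq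
  have hm : Measurable fun y : J → ℝ => ∫⁻ x, f y x ∂F := hf.lintegral_prod_right'
  calc ∫⁻ ω, f (fun j => X j ω) (X i ω) ∂P
      = ∫⁻ p, Function.uncurry f p ∂(P.map fun ω => ((fun j : J => X j ω), X i ω)) := by
        rw [lintegral_map hf (hXJ.prodMk (hX i))]; rfl
    _ = ∫⁻ y, ∫⁻ x, f y x ∂(condDistrib (X i) (fun ω (j : J) => X j ω) P y)
          ∂(P.map fun ω (j : J) => X j ω) := by
        rw [← compProd_map_condDistrib (hX i).aemeasurable, Measure.lintegral_compProd hf]; rfl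
    _ ≤ ∫⁻ y, c * ∫⁻ x, f y x ∂F ∂(P.map fun ω (j : J) => X j ω) := by
        refine lintegral_mono_ae ?_
        filter_upwards [hae] with y hy
        by_cases hyj : ∀ j, b < y j
        · have : IsFiniteMeasure (c • F) := Measure.smul_finite F hc
          rw [← smul_eq_mul, ← lintegral_smul_measure]
          refine lintegral_le_of_tail_le (b := b) (fun t ht => ?_) (hmono y) (hb y) (htop y)
          -- `(t, ∞)` is the increasing union of the half-lines with rational endpoints above `t`
          have hU : Ioi t = ⋃ q : {q : ℚ // t < q}, Ioi ((q : ℚ) : ℝ) := by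
            ext x
            simp only [mem_Ioi, mem_iUnion, Subtype.exists, exists_prop]
            exact ⟨fun hx => exists_rat_btwn hx, fun ⟨q, h1, h2⟩ => h1.trans h2⟩
          have hdir : Directed (· ⊆ ·) fun q : {q : ℚ // t < q} => Ioi ((q : ℚ) : ℝ) :=
            directed_of_isDirected_ge fun p q hpq => Ioi_subset_Ioi (by exact_mod_cast hpq)
          rw [hU, hdir.measure_iUnion, ← hU]
          refine iSup_le fun q => (hy q (ht.trans_lt q.2) hyj).trans ?_
          rw [Measure.smul_apply, smul_eq_mul]
          gcongr
          exact q.2.le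
        · simp [hyb y _ hyj]
    _ = c * ∫⁻ ω, ∫⁻ x, f (fun j => X j ω) x ∂F ∂P := by
        rw [lintegral_const_mul _ hm, lintegral_map hm hXJ]

/-- Kesten-type bound for the sum over `J` on the event that all its terms exceed `b`. If the
convolution square of `F` restricted to `(b, ∞)` has tail at most `δ` times that of the restriction
itself, then each further term costs a factor `c * δ`. -/
lemma measure_sum_gt_le {P : Measure Ω} [IsFiniteMeasure P] {F : Measure ℝ}
    {X : ℕ → Ω → ℝ} {b : ℝ} {c δ : ℝ≥0∞} (hX : ∀ k, Measurable (X k)) (hF : ∀ k, P.map (X k) = F)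
    (hc : c ≠ ∞) (h : CondTailBoundWith P X b c)
    (hG : ∀ x, ∫⁻ y, F.restrict (Ioi b) (Ioi (x - y)) ∂(F.restrict (Ioi b))
      ≤ δ * F.restrict (Ioi b) (Ioi x)) {J : Finset ℕ} (hJ : J.Nonempty) (x : ℝ) :
    P {ω | (∀ j ∈ J, b < X j ω) ∧ x < ∑ j ∈ J, X j ω}
      ≤ (c * δ) ^ (J.card - 1) * F.restrict (Ioi b) (Ioi x) := by
  have hFin : IsFiniteMeasure F := by rw [← hF 0]; infer_instance
  induction hJ using Finset.Nonempty.cons_induction generalizing x with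
  | singleton a =>
    simp only [Finset.mem_singleton, forall_eq, Finset.sum_singleton, Finset.card_singleton,
      Nat.sub_self, pow_zero, one_mul]
    rw [Measure.restrict_apply measurableSet_Ioi, ← hF a,
      Measure.map_apply (hX a) (measurableSet_Ioi.inter measurableSet_Ioi)]
    refine measure_mono fun ω hω => ⟨hω.2, hω.1⟩
  | cons i J hi hJ ih =>
    classical
    set f : (J → ℝ) → ℝ → ℝ≥0∞ := fun y t =>
      {p : (J → ℝ) × ℝ | (∀ j, b < p.1 j) ∧ b < p.2 ∧ x < ∑ j, p.1 j + p.2}.indicator 1 (y, t)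
      with hf_def
    have hset : MeasurableSet
        {p : (J → ℝ) × ℝ | (∀ j, b < p.1 j) ∧ b < p.2 ∧ x < ∑ j, p.1 j + p.2} := by
      measurability
    have hf : Measurable (Function.uncurry f) := measurable_one.indicator hset
    have hsum : ∀ ω, ∑ j : J, X j ω = ∑ j ∈ J, X j ω := fun ω =>
      Finset.sum_coe_sort J fun j => X j ω
    have hSJ : Measurable fun ω => ∑ j ∈ J, X j ω := Finset.measurable_sum _ fun j _ => hX j
    have hall : MeasurableSet {ω | ∀ j ∈ J, b < X j ω} := by
      have : {ω | ∀ j ∈ J, b < X j ω} = ⋂ j ∈ J, {ω | b < X j ω} := by ext; simp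
      rw [this]
      exact Finset.measurableSet_biInter _ fun j _ => measurableSet_lt measurable_const (hX j)
    have hfX : ∀ ω t, f (fun j => X j ω) t
        = (Ioi b).indicator (fun t => {ω | (∀ j ∈ J, b < X j ω) ∧ x - t < ∑ j ∈ J, X j ω}.indicator
            1 ω) t := fun ω t => by
      simp only [hf_def, indicator, mem_ofPred_eq, hsum, Subtype.forall, mem_Ioi, Pi.one_apply,
        sub_lt_iff_lt_add]
      split_ifs <;> tauto
    calc P {ω | (∀ j ∈ Finset.cons i J hi, b < X j ω) ∧ x < ∑ j ∈ Finset.cons i J hi, X j ω}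
        = ∫⁻ ω, f (fun j => X j ω) (X i ω) ∂P := by
          rw [← lintegral_indicator_one]
          · refine lintegral_congr fun ω => ?_
            simp only [hf_def, indicator, mem_ofPred_eq, hsum, Subtype.forall, Pi.one_apply,
              Finset.mem_cons, forall_eq_or_imp, Finset.sum_cons, add_comm (X i ω)]
            split_ifs <;> tauto
          · simp only [Finset.mem_cons, forall_eq_or_imp, Finset.sum_cons]
            exact ((measurableSet_lt measurable_const (hX i)).inter hall).inter
              (measurableSet_lt measurable_const ((hX i).add hSJ))
      _ ≤ c * ∫⁻ ω, ∫⁻ t, f (fun j => X j ω) t ∂F ∂P := by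
          refine lintegral_le_of_condTailBoundWith hX hF hc h hJ hi hf ?_ ?_ ?_ ?_
          · intro y s t hst
            by_cases hs : (∀ j, b < y j) ∧ b < s ∧ x < ∑ j, y j + s
            · have ht : (∀ j, b < y j) ∧ b < t ∧ x < ∑ j, y j + t :=
                ⟨hs.1, hs.2.1.trans_le hst, hs.2.2.trans_le (by gcongr)⟩
              simp only [hf_def]
              rw [indicator_of_mem (show (y, s) ∈ _ from hs),
                indicator_of_mem (show (y, t) ∈ _ from ht)]
              rfl
            · simp only [hf_def]
              rw [indicator_of_notMem (show (y, s) ∉ _ from hs)]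
              exact zero_le
          · intro y t ht
            simp [hf_def, not_lt.2 ht]
          · intro y t hy
            exact indicator_of_notMem (fun hp => hy hp.1) _
          · intro y t
            simp only [hf_def, indicator]
            split_ifs <;> simp
      _ = c * ∫⁻ t in Ioi b, P {ω | (∀ j ∈ J, b < X j ω) ∧ x - t < ∑ j ∈ J, X j ω} ∂F := by
          have hfm : Measurable (Function.uncurry fun ω t => f (fun j : J => X j ω) t) :=
            hf.comp (((measurable_pi_lambda (fun ω (j : J) => X j ω) fun j => hX j).comp
              measurable_fst).prodMk measurable_snd)
          rw [lintegral_lintegral_swap (f := fun ω t => f (fun j : J => X j ω) t)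
            hfm.aemeasurable, ← lintegral_indicator measurableSet_Ioi]
          congr 1
          refine lintegral_congr fun t => ?_
          simp only [hfX]
          by_cases ht : t ∈ Ioi b
          · simp only [indicator_of_mem ht]
            rw [lintegral_indicator_one]
            exact hall.inter (measurableSet_lt measurable_const hSJ)
          · simp [indicator_of_notMem ht]
      _ ≤ c * ∫⁻ t in Ioi b, (c * δ) ^ (J.card - 1) * F.restrict (Ioi b) (Ioi (x - t)) ∂F := by
          gcongr with t
          exact ih (x - t)
      _ = c * ((c * δ) ^ (J.card - 1) * ∫⁻ t in Ioi b, F.restrict (Ioi b) (Ioi (x - t)) ∂F) := by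
          rw [lintegral_const_mul]
          have : Antitone fun t => F.restrict (Ioi b) (Ioi t) := fun s t hst =>
            measure_mono (Ioi_subset_Ioi hst)
          exact this.measurable.comp (measurable_const.sub measurable_id)
      _ ≤ c * ((c * δ) ^ (J.card - 1) * (δ * F.restrict (Ioi b) (Ioi x))) := by
          gcongr
          exact hG x
      _ = _ := by
          rw [Finset.card_cons, Nat.add_sub_cancel]
          conv_rhs => rw [← Nat.sub_add_cancel (Finset.card_pos.2 hJ), pow_succ]
          ring

/-- The product moments of a monotone function of the large terms factorize up to powers of `c`. -/
lemma lintegral_prod_le {P : Measure Ω} [IsFiniteMeasure P] {F : Measure ℝ}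
    {X : ℕ → Ω → ℝ} {b : ℝ} {c : ℝ≥0∞} (hX : ∀ k, Measurable (X k)) (hF : ∀ k, P.map (X k) = F)
    (hc : c ≠ ∞) (h : CondTailBoundWith P X b c) {v : ℝ → ℝ≥0∞} (hv : Monotone v)
    (hvb : ∀ x ≤ b, v x = 0) (hvt : ∀ x, v x ≠ ∞) {J : Finset ℕ} (hJ : J.Nonempty) :
    ∫⁻ ω, ∏ j ∈ J, v (X j ω) ∂P
      ≤ (∫⁻ x, v x ∂F) * (c * ∫⁻ x, v x ∂F) ^ (J.card - 1) := by
  induction hJ using Finset.Nonempty.cons_induction with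
  | singleton a =>
    simp [← hF a, lintegral_map hv.measurable (hX a)]
  | cons i J hi hJ ih =>
    have hprod : ∀ ω, ∏ j : J, v (X j ω) = ∏ j ∈ J, v (X j ω) := fun ω =>
      Finset.prod_coe_sort J fun j => v (X j ω)
    have hm : Measurable fun ω => ∏ j ∈ J, v (X j ω) :=
      Finset.measurable_prod _ fun j _ => hv.measurable.comp (hX j)
    calc ∫⁻ ω, ∏ j ∈ Finset.cons i J hi, v (X j ω) ∂P
        = ∫⁻ ω, (fun (y : J → ℝ) x => (∏ j, v (y j)) * v x) (fun j => X j ω) (X i ω) ∂P := by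
          refine lintegral_congr fun ω => ?_
          simp only [hprod, Finset.prod_cons, mul_comm]
      _ ≤ c * ∫⁻ ω, ∫⁻ x, (∏ j : J, v (X j ω)) * v x ∂F ∂P := by
          refine lintegral_le_of_condTailBoundWith hX hF hc h hJ hi
            (f := fun (y : J → ℝ) x => (∏ j, v (y j)) * v x) ?_ ?_ ?_ ?_ ?_
          · have := hv.measurable
            simp only [Function.uncurry_def]
            fun_prop
          · intro y s t hst
            exact mul_le_mul_right (hv hst) _
          · intro y x hx
            simp [hvb x hx]
          · intro y x hy
            push Not at hy
            obtain ⟨j, hj⟩ := hy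
            have : ∏ j, v (y j) = 0 := Finset.prod_eq_zero (Finset.mem_univ j) (hvb _ hj)
            simp only [this, zero_mul]
          · intro y x
            exact ENNReal.mul_ne_top (ENNReal.prod_ne_top fun j _ => hvt _) (hvt x)
      _ = c * ((∫⁻ ω, ∏ j ∈ J, v (X j ω) ∂P) * ∫⁻ x, v x ∂F) := by
          simp_rw [lintegral_const_mul _ hv.measurable, hprod]
          rw [lintegral_mul_const _ hm]
      _ ≤ c * (((∫⁻ x, v x ∂F) * (c * ∫⁻ x, v x ∂F) ^ (J.card - 1)) * ∫⁻ x, v x ∂F) := by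
          gcongr
      _ = _ := by
          rw [Finset.card_cons, Nat.add_sub_cancel]
          conv_rhs => rw [← Nat.sub_add_cancel (Finset.card_pos.2 hJ), pow_succ]
          ring

/-! ### Conditioning on the number of terms -/

/-- Conditioning on `τ`: by independence, `τ` may be frozen while the sequence is integrated. -/
lemma lintegral_comp_indep {P : Measure Ω} [IsProbabilityMeasure P] {X : ℕ → Ω → ℝ} {τ : Ω → ℕ}
    (hX : ∀ k, Measurable (X k)) (hτ : Measurable τ) (hindep : IndepFun τ (fun ω k => X k ω) P)
    {φ : ℕ → (ℕ → ℝ) → ℝ≥0∞} (hφ : ∀ n, Measurable (φ n)) :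
    ∫⁻ ω, φ (τ ω) (fun k => X k ω) ∂P = ∫⁻ ω, ∫⁻ ω', φ (τ ω) (fun k => X k ω') ∂P ∂P := by
  have hXs : Measurable fun ω k => X k ω := measurable_pi_lambda _ hX
  have hm : Measurable (Function.uncurry φ) := measurable_from_prod_countable_right hφ
  calc ∫⁻ ω, φ (τ ω) (fun k => X k ω) ∂P
      = ∫⁻ p, Function.uncurry φ p ∂(P.map fun ω => (τ ω, fun k => X k ω)) := by
        rw [lintegral_map hm (hτ.prodMk hXs)]; rfl
    _ = ∫⁻ n, ∫⁻ y, φ n y ∂(P.map fun ω k => X k ω) ∂(P.map τ) := by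
        have : IsProbabilityMeasure (P.map fun ω k => X k ω) :=
          Measure.isProbabilityMeasure_map hXs.aemeasurable
        rw [(indepFun_iff_map_prod_eq_prod_map_map hτ.aemeasurable hXs.aemeasurable).1 hindep,
          lintegral_prod _ hm.aemeasurable]
        rfl
    _ = _ := by
        rw [lintegral_map (measurable_of_countable _) hτ]
        refine lintegral_congr fun ω => ?_
        rw [lintegral_map (hφ _) hXs]

lemma measurable_randomSum {X : ℕ → Ω → ℝ} {τ : Ω → ℕ} (hX : ∀ k, Measurable (X k))
    (hτ : Measurable τ) : Measurable (randomSum X τ) := by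
  have hm : Measurable fun q : ℕ × Ω => ∑ k ∈ Finset.range q.1, X k q.2 :=
    measurable_from_prod_countable_right fun n =>
      (Finset.measurable_sum (Finset.range n) fun k _ => hX k :)
  exact hm.comp (hτ.prodMk measurable_id)

lemma measure_randomSum_gt {P : Measure Ω} [IsProbabilityMeasure P] {X : ℕ → Ω → ℝ} {τ : Ω → ℕ}
    (hX : ∀ k, Measurable (X k)) (hτ : Measurable τ) (hindep : IndepFun τ (fun ω k => X k ω) P)
    (x : ℝ) :
    P {ω | x < randomSum X τ ω}
      = ∫⁻ ω, P {ω' | x < ∑ k ∈ Finset.range (τ ω), X k ω'} ∂P := by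
  have hS : ∀ n, Measurable fun y : ℕ → ℝ => ∑ k ∈ Finset.range n, y k := fun n => by fun_prop
  have h := lintegral_comp_indep (φ := fun n y =>
    {y : ℕ → ℝ | x < ∑ k ∈ Finset.range n, y k}.indicator 1 y) hX hτ hindep
    fun n => measurable_one.indicator (measurableSet_lt measurable_const (hS n))
  have hSX : ∀ n, Measurable fun ω => ∑ k ∈ Finset.range n, X k ω := fun n =>
    (hS n).comp (measurable_pi_lambda _ hX)
  have h2 : ∀ n, P {ω' | x < ∑ k ∈ Finset.range n, X k ω'} = ∫⁻ ω',
      {y : ℕ → ℝ | x < ∑ k ∈ Finset.range n, y k}.indicator 1 (fun k => X k ω') ∂P := fun n => by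
    rw [← lintegral_indicator_one (measurableSet_lt measurable_const (hSX n))]
    rfl
  simp_rw [h2]
  rw [← h, ← lintegral_indicator_one]
  · rfl
  · exact measurableSet_lt measurable_const (measurable_randomSum hX hτ)

/-! ### The lower bound for long-tailed distributions -/

lemma tail_ne_zero {F : Measure ℝ} [IsFiniteMeasure F] (h : HeavyTailed F) (x : ℝ) :
    tail F x ≠ 0 := by
  intro h0
  refine (lt_irrefl (∞ : ℝ≥0∞)) ?_
  calc ∞ = ∫⁻ y, ENNReal.ofReal (Real.exp (1 * y)) ∂F := (h 1 one_pos).symm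
    _ ≤ ∫⁻ _, ENNReal.ofReal (Real.exp x) ∂F := by
        refine lintegral_mono_ae ?_
        have : ∀ᵐ y ∂F, y ∉ Ioi x := measure_eq_zero_iff_ae_notMem.1 h0
        filter_upwards [this] with y hy
        gcongr
        simpa using hy
    _ < ∞ := by
        rw [lintegral_const]
        exact ENNReal.mul_lt_top ENNReal.ofReal_lt_top (measure_lt_top _ _)

/-- Asymptotic independence with one threshold for all pairs of indices below `n`. -/
lemma PairwiseAsympIndep.exists_forall_le {P : Measure Ω} [IsFiniteMeasure P] {X : ℕ → Ω → ℝ}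
    (hX : ∀ k, Measurable (X k)) (h : PairwiseAsympIndep P X) {ε : ℝ≥0∞} (hε : 0 < ε) (n : ℕ) :
    ∃ L > 0, ∀ i < n, ∀ j < n, j ≠ i → ∀ u ≥ L, ∀ v ≥ L,
      P {ω | v < X i ω ∧ u < |X j ω|} ≤ ε * P {ω | v < X i ω} := by
  have key : ∀ i j, j ≠ i → ∃ L : ℝ, ∀ u ≥ L, ∀ v ≥ L,
      P {ω | v < X i ω ∧ u < |X j ω|} ≤ ε * P {ω | v < X i ω} := by
    intro i j hij
    have hev := (h j i hij).eventually (gt_mem_nhds hε)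
    obtain ⟨A, hA, B, hB, hAB⟩ := Filter.mem_prod_iff.1 hev
    obtain ⟨a, ha⟩ := mem_atTop_sets.1 hA
    obtain ⟨b, hb⟩ := mem_atTop_sets.1 hB
    refine ⟨max a b, fun u hu v hv => ?_⟩
    have hlt : (cond P {ω | v < X i ω}) {ω | u < |X j ω|} < ε :=
      @hAB (u, v) ⟨ha u ((le_max_left _ _).trans hu), hb v ((le_max_right _ _).trans hv)⟩
    rw [cond_apply (measurableSet_lt measurable_const (hX i))] at hlt
    change P ({ω | v < X i ω} ∩ {ω | u < |X j ω|}) ≤ _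
    rcases eq_or_ne (P {ω | v < X i ω}) 0 with h0 | h0
    · rw [measure_mono_null inter_subset_left h0]
      exact zero_le
    · rw [mul_comm, ← div_eq_mul_inv] at hlt
      exact (ENNReal.div_le_iff_le_mul (.inl h0) (.inl (measure_ne_top _ _))).1 hlt.le
  choose! L hL using key
  refine ⟨∑ i ∈ Finset.range n, ∑ j ∈ Finset.range n, |L i j| + 1, by positivity, ?_⟩
  intro i hi j hj hij u hu v hv
  have hle : L i j ≤ ∑ i ∈ Finset.range n, ∑ j ∈ Finset.range n, |L i j| + 1 := by
    calc L i j ≤ |L i j| := le_abs_self _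
      _ ≤ ∑ j ∈ Finset.range n, |L i j| :=
        Finset.single_le_sum (f := fun j => |L i j|) (fun _ _ => abs_nonneg _) (by simpa using hj)
      _ ≤ ∑ i ∈ Finset.range n, ∑ j ∈ Finset.range n, |L i j| :=
        Finset.single_le_sum (f := fun i => ∑ j ∈ Finset.range n, |L i j|)
          (fun _ _ => Finset.sum_nonneg fun _ _ => abs_nonneg _) (by simpa using hi)
      _ ≤ _ := by linarith
  exact hL i j hij u (hle.trans hu) v (hle.trans hv)

/-- One big jump, from below: the events that `X i` exceeds `x + n * L` while the other terms lie in
`[-L, L]` are disjoint, force the sum above `x`, and each has almost the probability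
`tail F (x + n * L)`. -/
lemma card_mul_tail_le {P : Measure Ω} [IsFiniteMeasure P] {F : Measure ℝ} {X : ℕ → Ω → ℝ}
    (hX : ∀ k, Measurable (X k)) (hF : ∀ k, P.map (X k) = F) {ε : ℝ≥0∞} {n : ℕ} {L : ℝ}
    (hL : 0 < L) (h : ∀ i < n, ∀ j < n, j ≠ i → ∀ u ≥ L, ∀ v ≥ L,
      P {ω | v < X i ω ∧ u < |X j ω|} ≤ ε * P {ω | v < X i ω}) {x : ℝ} (hx : 0 ≤ x) :
    n * tail F (x + n * L)
      ≤ P {ω | x < ∑ k ∈ Finset.range n, X k ω} + n * n * ε * tail F (x + n * L) := by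
  have htail : ∀ i x, P {ω | x < X i ω} = tail F x := fun i x => by
    rw [tail, ← hF i, Measure.map_apply (hX i) measurableSet_Ioi]; rfl
  set E : ℕ → Set Ω := fun i =>
    {ω | x + n * L < X i ω} ∩ ⋂ j ∈ (Finset.range n).erase i, {ω | |X j ω| ≤ L} with hE
  have hEmeas : ∀ i, MeasurableSet (E i) := fun i =>
    (measurableSet_lt measurable_const (hX i)).inter <|
      Finset.measurableSet_biInter _ fun j _ => measurableSet_le (hX j).abs measurable_const
  have hEdisj : Set.PairwiseDisjoint (Finset.range n : Set ℕ) E := by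
    intro i hi j hj hij
    refine Set.disjoint_left.2 fun ω hωi hωj => ?_
    simp only [Finset.coe_range, mem_Iio] at hi hj
    have h1 : x + n * L < X i ω := hωi.1
    have h2 : |X i ω| ≤ L := by
      have := hωj.2
      simp only [mem_iInter] at this
      exact this i (by simp [hij, hi])
    have h3 : (1 : ℝ) ≤ n := by exact_mod_cast (Nat.zero_le i).trans_lt hi
    nlinarith [le_abs_self (X i ω)]
  have hEsub : ⋃ i ∈ Finset.range n, E i ⊆ {ω | x < ∑ k ∈ Finset.range n, X k ω} := by
    intro ω hω
    simp only [mem_iUnion] at hω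
    obtain ⟨i, hi, hωi, hωj⟩ := hω
    simp only [mem_iInter] at hωj
    have h1 : -(n * L) ≤ ∑ k ∈ (Finset.range n).erase i, X k ω := by
      calc -(n * L) ≤ ∑ k ∈ (Finset.range n).erase i, (-L) := by
            rw [Finset.sum_const, Finset.card_erase_of_mem hi, Finset.card_range, nsmul_eq_mul]
            have : ((n - 1 : ℕ) : ℝ) ≤ n := by exact_mod_cast Nat.sub_le n 1
            nlinarith
        _ ≤ _ := Finset.sum_le_sum fun k hk => (abs_le.1 (hωj k hk)).1
    have h2 : x + n * L < X i ω := hωi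
    change x < ∑ k ∈ Finset.range n, X k ω
    rw [← Finset.add_sum_erase _ _ hi]
    linarith
  have hEi : ∀ i ∈ Finset.range n,
      tail F (x + n * L) ≤ P (E i) + n * (ε * tail F (x + n * L)) := by
    intro i hi
    have hn : (1 : ℝ) ≤ n := by
      exact_mod_cast (Nat.zero_le i).trans_lt (Finset.mem_range.1 hi)
    have hsub : {ω | x + n * L < X i ω} ⊆ E i ∪ ⋃ j ∈ (Finset.range n).erase i,
        {ω | x + n * L < X i ω ∧ L < |X j ω|} := by
      intro ω hω
      by_cases hall : ∀ j ∈ (Finset.range n).erase i, |X j ω| ≤ L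
      · exact .inl ⟨hω, by simpa using hall⟩
      · push Not at hall
        obtain ⟨j, hj, hjL⟩ := hall
        exact .inr (mem_iUnion₂.2 ⟨j, hj, hω, hjL⟩)
    calc tail F (x + n * L) = P {ω | x + n * L < X i ω} := (htail i _).symm
      _ ≤ P (E i) + ∑ j ∈ (Finset.range n).erase i, P {ω | x + n * L < X i ω ∧ L < |X j ω|} :=
        (measure_mono hsub).trans <| (measure_union_le _ _).trans <|
          add_le_add le_rfl (measure_biUnion_finset_le _ _)
      _ ≤ P (E i) + ∑ j ∈ (Finset.range n).erase i, ε * tail F (x + n * L) := by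
        gcongr with j hj
        rw [← htail i]
        have hj' := Finset.mem_erase.1 hj
        exact h i (Finset.mem_range.1 hi) j (Finset.mem_range.1 hj'.2) hj'.1 L le_rfl _
          (by nlinarith)
      _ ≤ _ := by
        rw [Finset.sum_const, nsmul_eq_mul]
        gcongr
        exact (Finset.card_erase_le).trans (Finset.card_range n).le
  calc n * tail F (x + n * L) = ∑ i ∈ Finset.range n, tail F (x + n * L) := by simp
    _ ≤ ∑ i ∈ Finset.range n, (P (E i) + n * (ε * tail F (x + n * L))) := Finset.sum_le_sum hEi
    _ = P (⋃ i ∈ Finset.range n, E i) + n * n * ε * tail F (x + n * L) := by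
      rw [Finset.sum_add_distrib, measure_biUnion_finset hEdisj fun i _ => hEmeas i]
      simp [mul_assoc]
    _ ≤ _ := by gcongr

lemma eventually_lt_measure_sum_gt_div_tail {P : Measure Ω} [IsFiniteMeasure P] {F : Measure ℝ}
    {X : ℕ → Ω → ℝ} (hX : ∀ k, Measurable (X k)) (hF : ∀ k, P.map (X k) = F)
    (hlong : LongTailed F) (hind : PairwiseAsympIndep P X) (n : ℕ)
    {a : ℝ≥0∞} (ha : a < n) :
    ∀ᶠ x in atTop, a < P {ω | x < ∑ k ∈ Finset.range n, X k ω} / tail F x := by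
  have hFin : IsFiniteMeasure F := by rw [← hF 0]; infer_instance
  obtain ⟨a', haa', ha'⟩ := exists_between ha
  have hdiff : 0 < a' - a := tsub_pos_of_lt haa'
  have hn0 : (n * n : ℝ≥0∞) ≠ 0 := by
    have : (n : ℝ≥0∞) ≠ 0 := (zero_le.trans_lt ha).ne'
    exact mul_ne_zero this this
  have hnt : (n * n : ℝ≥0∞) ≠ ∞ :=
    ENNReal.mul_ne_top (ENNReal.natCast_ne_top n) (ENNReal.natCast_ne_top n)
  obtain ⟨L, hL, hind'⟩ := hind.exists_forall_le hX
    (ENNReal.div_pos hdiff.ne' hnt : 0 < (a' - a) / (n * n)) n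
  have hlim : Tendsto (fun x => n * (tail F (x + n * L) / tail F x)) atTop (𝓝 (n : ℝ≥0∞)) := by
    simpa using ENNReal.Tendsto.const_mul (a := (n : ℝ≥0∞)) (hlong (n * L))
      (.inl one_ne_zero)
  filter_upwards [hlim.eventually (lt_mem_nhds ha'), eventually_ge_atTop 0] with x hx hx0
  have hmono : tail F (x + n * L) / tail F x ≤ 1 := by
    refine ENNReal.div_le_of_le_mul ?_
    rw [one_mul]
    exact measure_mono (Ioi_subset_Ioi (le_add_of_nonneg_right (by positivity)))
  have hmain := card_mul_tail_le hX hF hL hind' hx0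
  have h2 : n * (tail F (x + n * L) / tail F x)
      ≤ P {ω | x < ∑ k ∈ Finset.range n, X k ω} / tail F x + (a' - a) := by
    calc n * (tail F (x + n * L) / tail F x) = n * tail F (x + n * L) / tail F x := by
          rw [mul_div_assoc]
      _ ≤ (P {ω | x < ∑ k ∈ Finset.range n, X k ω}
            + n * n * ((a' - a) / (n * n)) * tail F (x + n * L)) / tail F x := by gcongr
      _ = P {ω | x < ∑ k ∈ Finset.range n, X k ω} / tail F x
            + (a' - a) * (tail F (x + n * L) / tail F x) := by
          rw [ENNReal.mul_div_cancel hn0 hnt, ENNReal.add_div, mul_div_assoc]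
      _ ≤ P {ω | x < ∑ k ∈ Finset.range n, X k ω} / tail F x + (a' - a) * 1 := by gcongr
      _ = _ := by rw [mul_one]
  by_contra hcon
  have : n * (tail F (x + n * L) / tail F x) ≤ a' :=
    h2.trans ((add_le_add (not_lt.1 hcon) le_rfl).trans (add_tsub_cancel_of_le haa'.le).le)
  exact (hx.trans_le this).false

/-- The lower half of both claims; it needs long tails and pairwise asymptotic independence only. -/
lemma lintegral_le_liminf {P : Measure Ω} [IsProbabilityMeasure P] {F : Measure ℝ}
    {X : ℕ → Ω → ℝ} {τ : Ω → ℕ} (hX : ∀ k, Measurable (X k)) (hF : ∀ k, P.map (X k) = F)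
    (hlong : LongTailed F) (hind : PairwiseAsympIndep P X)
    (hτ : Measurable τ) (hindep : IndepFun τ (fun ω k => X k ω) P)
    (hfin : ∫⁻ ω, (τ ω : ℝ≥0∞) ∂P ≠ ∞) :
    ∫⁻ ω, (τ ω : ℝ≥0∞) ∂P
      ≤ liminf (fun x : ℝ => P {ω | x < randomSum X τ ω} / tail F x) atTop := by
  -- dominated convergence for the truncations `min (P(S_τ > x) / tail F x) τ`, conditionally on `τ`
  have hlim : Tendsto (fun x : ℝ => ∫⁻ ω,
      min (P {ω' | x < ∑ k ∈ Finset.range (τ ω), X k ω'} / tail F x) (τ ω) ∂P) atTop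
      (𝓝 (∫⁻ ω, (τ ω : ℝ≥0∞) ∂P)) := by
    refine tendsto_lintegral_filter_of_dominated_convergence (fun ω => (τ ω : ℝ≥0∞))
      (.of_forall fun x => ?_) (.of_forall fun x => .of_forall fun ω => min_le_right _ _) hfin
      (.of_forall fun ω => ?_)
    · exact (measurable_of_countable fun n : ℕ =>
        min (P {ω' | x < ∑ k ∈ Finset.range n, X k ω'} / tail F x) (n : ℝ≥0∞)).comp hτ
    · refine tendsto_order.2 ⟨fun a ha => ?_, fun a ha => .of_forall fun x =>
        (min_le_right _ _).trans_lt ha⟩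
      filter_upwards [eventually_lt_measure_sum_gt_div_tail hX hF hlong hind (τ ω) ha]
        with x hx using lt_min hx ha
  rw [← hlim.liminf_eq]
  refine liminf_le_liminf (.of_forall fun x => ?_)
  rw [measure_randomSum_gt hX hτ hindep, ENNReal.div_eq_inv_mul, ← lintegral_const_mul]
  · refine lintegral_mono fun ω => (min_le_left _ _).trans ?_
    rw [ENNReal.div_eq_inv_mul]
  · exact (measurable_of_countable fun n : ℕ =>
        P {ω' | x < ∑ k ∈ Finset.range n, X k ω'}).comp hτ

/-! ### Truncated exponential moments of sums -/

/-- The test function `x ↦ exp (α * min x⁺ t) - 1`, a bounded exponential that vanishes on the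
negative half-line; `1 + truncExp α t` is submultiplicative. -/
noncomputable def truncExp (α t x : ℝ) : ℝ≥0∞ := ENNReal.ofReal (Real.exp (α * min (max x 0) t) - 1)

section truncExp
variable {α t : ℝ}

lemma one_add_truncExp (hα : 0 ≤ α) (ht : 0 ≤ t) (x : ℝ) :
    1 + truncExp α t x = ENNReal.ofReal (Real.exp (α * min (max x 0) t)) := by
  have : 1 ≤ Real.exp (α * min (max x 0) t) := Real.one_le_exp (by positivity)
  rw [truncExp, ← ENNReal.ofReal_one, ← ENNReal.ofReal_add zero_le_one (by linarith)]
  ring_nf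

lemma truncExp_mono (hα : 0 ≤ α) : Monotone (truncExp α t) := fun x y hxy => by
  unfold truncExp
  gcongr

lemma truncExp_le (hα : 0 ≤ α) {b x : ℝ} (hb : 0 ≤ b) (hx : x ≤ b) :
    truncExp α t x ≤ ENNReal.ofReal (Real.exp (α * b) - 1) := by
  unfold truncExp
  gcongr
  exact (min_le_left _ _).trans (max_le hx hb)

lemma one_add_truncExp_sum_le (hα : 0 ≤ α) (ht : 0 ≤ t) {ι : Type*} (s : Finset ι) (y : ι → ℝ) :
    1 + truncExp α t (∑ k ∈ s, y k) ≤ ∏ k ∈ s, (1 + truncExp α t (y k)) := by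
  induction s using Finset.cons_induction with
  | empty => simp [truncExp, ht]
  | cons a s ha ih =>
    rw [Finset.sum_cons, Finset.prod_cons]
    refine le_trans ?_ (mul_le_mul_right ih _)
    rw [one_add_truncExp hα ht, one_add_truncExp hα ht, one_add_truncExp hα ht,
      ← ENNReal.ofReal_mul (Real.exp_pos _).le, ← Real.exp_add, ← mul_add]
    gcongr
    rcases le_total (max (y a) 0) t with h1 | h1 <;>
    rcases le_total (max (∑ k ∈ s, y k) 0) t with h2 | h2
    · rw [min_eq_left h1, min_eq_left h2]
      refine (min_le_left _ _).trans (max_le ?_ (by positivity))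
      exact add_le_add (le_max_left _ _) (le_max_left _ _)
    · rw [min_eq_right h2]
      exact (min_le_right _ _).trans (le_add_of_nonneg_left (by positivity))
    · rw [min_eq_right h1]
      exact (min_le_right _ _).trans (le_add_of_nonneg_right (by positivity))
    · rw [min_eq_right h2]
      exact (min_le_right _ _).trans (le_add_of_nonneg_left (by positivity))

end truncExp

/-- The first-order bound for `(1 + η) ^ n - 1`, written without subtraction. -/
lemma one_add_pow_le (η : ℝ≥0∞) (n : ℕ) : (1 + η) ^ n ≤ 1 + n * η * (1 + η) ^ n := by
  induction n with
  | zero => simp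
  | succ n ih =>
    calc (1 + η) ^ (n + 1) = (1 + η) ^ n + η * (1 + η) ^ n := by ring
      _ ≤ 1 + n * η * (1 + η) ^ n + η * (1 + η) ^ n := by gcongr
      _ = 1 + (n + 1 : ℕ) * η * (1 + η) ^ n := by push_cast; ring
      _ ≤ 1 + (n + 1 : ℕ) * η * (1 + η) ^ (n + 1) := by
        gcongr
        · exact le_self_add
        · exact Nat.le_succ n

lemma monotone_indicator_Ioi {f : ℝ → ℝ≥0∞} (hf : Monotone f) (b : ℝ) :
    Monotone ((Ioi b).indicator f) := by
  intro x y hxy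
  by_cases hx : b < x
  · rw [indicator_of_mem (show x ∈ Ioi b from hx),
      indicator_of_mem (show y ∈ Ioi b from hx.trans_le hxy)]
    exact hf hxy
  · rw [indicator_of_notMem (show x ∉ Ioi b from hx)]
    exact zero_le

/-- The moment of `truncExp` along a sum of `n` terms is at most `n * (η + d)`, up to a factor whose
`n`-th root is close to `1`. Terms up to `b` contribute `η` each. The product of the factors
`1 + truncExp` of the terms beyond `b` is expanded over index sets `J`, whose contributions decay
like `(c * d) ^ (|J| - 1)`. -/
lemma lintegral_truncExp_sum_le {P : Measure Ω} [IsProbabilityMeasure P] {F : Measure ℝ}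
    {X : ℕ → Ω → ℝ} {b : ℝ} {c : ℝ≥0∞} (hX : ∀ k, Measurable (X k)) (hF : ∀ k, P.map (X k) = F)
    (hc : c ≠ ∞) (h : CondTailBoundWith P X b c) (hb : 0 ≤ b) {α t : ℝ} (hα : 0 ≤ α) (ht : 0 ≤ t)
    {η d : ℝ≥0∞} (hη : η = ENNReal.ofReal (Real.exp (α * b) - 1))
    (hd : ∫⁻ x, truncExp α t x ∂F ≤ d) (n : ℕ) :
    ∫⁻ ω, truncExp α t (∑ k ∈ Finset.range n, X k ω) ∂P
      ≤ (η + d) * (n * ((1 + η) * (1 + c * d)) ^ n) := by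
  set v : ℝ → ℝ≥0∞ := (Ioi b).indicator (truncExp α t) with hv
  have hvmono : Monotone v := monotone_indicator_Ioi (truncExp_mono hα) b
  have hvb : ∀ x ≤ b, v x = 0 := fun x hx => indicator_of_notMem (show x ∉ Ioi b from not_lt.2 hx) _
  have hvle : ∀ x, v x ≤ truncExp α t x := fun x => indicator_le_self _ _ _
  have hvt : ∀ x, v x ≠ ∞ := fun x => ((hvle x).trans_lt ENNReal.ofReal_lt_top).ne
  have hvd : ∫⁻ x, v x ∂F ≤ d := (lintegral_mono hvle).trans hd
  have hpt : ∀ x, 1 + truncExp α t x ≤ (1 + η) * (1 + v x) := fun x => by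
    by_cases hx : b < x
    · rw [hv, indicator_of_mem (show x ∈ Ioi b from hx)]
      exact le_mul_of_one_le_left' le_self_add
    · rw [hvb x (not_lt.1 hx), add_zero, mul_one, hη]
      gcongr
      exact truncExp_le hα hb (not_lt.1 hx)
  have hJ : ∀ J ∈ (Finset.range n).powerset, ∫⁻ ω, ∏ j ∈ J, v (X j ω) ∂P
      ≤ (if J = ∅ then 1 else 0) + d * (if J.Nonempty then (c * d) ^ (J.card - 1) else 0) := by
    intro J _
    rcases J.eq_empty_or_nonempty with rfl | hne
    · simp
    · rw [if_neg hne.ne_empty, if_pos hne, zero_add]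
      refine (lintegral_prod_le hX hF hc h hvmono hvb hvt hne).trans ?_
      gcongr
  have hprodm : Measurable fun ω => ∏ k ∈ Finset.range n, (1 + v (X k ω)) :=
    Finset.measurable_prod _ fun k _ => measurable_const.add (hvmono.measurable.comp (hX k))
  have key : 1 + ∫⁻ ω, truncExp α t (∑ k ∈ Finset.range n, X k ω) ∂P
      ≤ 1 + (η + d) * (n * ((1 + η) * (1 + c * d)) ^ n) := by
    calc 1 + ∫⁻ ω, truncExp α t (∑ k ∈ Finset.range n, X k ω) ∂P
        = ∫⁻ ω, (1 + truncExp α t (∑ k ∈ Finset.range n, X k ω)) ∂P := by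
          rw [lintegral_add_left measurable_const]; simp
      _ ≤ ∫⁻ ω, (1 + η) ^ n * ∏ k ∈ Finset.range n, (1 + v (X k ω)) ∂P := by
          refine lintegral_mono fun ω => (one_add_truncExp_sum_le hα ht _ _).trans ?_
          calc _ ≤ ∏ k ∈ Finset.range n, ((1 + η) * (1 + v (X k ω))) :=
                Finset.prod_le_prod' fun k _ => hpt _
            _ = _ := by rw [Finset.prod_mul_distrib]; simp
      _ = (1 + η) ^ n * ∑ J ∈ (Finset.range n).powerset, ∫⁻ ω, ∏ j ∈ J, v (X j ω) ∂P := by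
          rw [lintegral_const_mul _ hprodm, ← lintegral_finsetSum]
          · simp_rw [Finset.prod_one_add]
          · exact fun J _ => Finset.measurable_prod _ fun j _ => hvmono.measurable.comp (hX j)
      _ ≤ (1 + η) ^ n * ∑ J ∈ (Finset.range n).powerset,
            ((if J = ∅ then 1 else 0)
              + d * (if J.Nonempty then (c * d) ^ (J.card - 1) else 0)) := by
          gcongr with J hJ'
          exact hJ J hJ'
      _ = (1 + η) ^ n * (1 + d * ∑ J ∈ (Finset.range n).powerset,
            (if J.Nonempty then (c * d) ^ (J.card - 1) else 0)) := by
          rw [Finset.sum_add_distrib, ← Finset.mul_sum]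
          simp
      _ ≤ (1 + η) ^ n * (1 + d * (n * (1 + c * d) ^ n)) := by
          gcongr
          simpa using sum_powerset_pow_card_sub_one_le (Finset.range n) (c * d)
      _ = (1 + η) ^ n + d * (n * ((1 + η) * (1 + c * d)) ^ n) := by rw [mul_pow]; ring
      _ ≤ 1 + n * η * (1 + η) ^ n + d * (n * ((1 + η) * (1 + c * d)) ^ n) := by
          gcongr
          exact one_add_pow_le η n
      _ ≤ 1 + n * η * ((1 + η) * (1 + c * d)) ^ n + d * (n * ((1 + η) * (1 + c * d)) ^ n) := by
          gcongr
          exact le_mul_of_one_le_right' le_self_add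
      _ = _ := by ring
  exact (ENNReal.add_le_add_iff_left ENNReal.one_ne_top).1 key

/-! ### Exponential moments of the number of terms -/

/-- Domination of `n * r ^ n` by a multiple of `z ^ n`, uniformly in `r ≤ √z`, from Bernoulli's
inequality for `√z ^ n`. -/
lemma natCast_mul_pow_le {z : ℝ} (hz : 1 < z) {r : ℝ} (hr0 : 0 ≤ r) (hr : r ≤ √z) (n : ℕ) :
    n * r ^ n ≤ z ^ n / (√z - 1) := by
  have h1 : 1 < √z := by rwa [Real.lt_sqrt zero_le_one, one_pow]
  have h2 : 1 + n * (√z - 1) ≤ √z ^ n := by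
    simpa using one_add_mul_le_pow (a := √z - 1) (by linarith) n
  rw [le_div_iff₀ (by linarith)]
  calc n * r ^ n * (√z - 1) = n * (√z - 1) * r ^ n := by ring
    _ ≤ √z ^ n * √z ^ n := by
      gcongr
      linarith
    _ = z ^ n := by rw [← mul_pow, Real.mul_self_sqrt (by linarith)]

lemma tendsto_lintegral_mul_pow {P : Measure Ω} {τ : Ω → ℕ} (hτ : Measurable τ) {z : ℝ}
    (hz : 1 < z) (hzτ : Integrable (fun ω => z ^ τ ω) P) :
    Tendsto (fun r : ℝ => ∫⁻ ω, (τ ω : ℝ≥0∞) * ENNReal.ofReal r ^ τ ω ∂P) (𝓝 1)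
      (𝓝 (∫⁻ ω, (τ ω : ℝ≥0∞) ∂P)) := by
  have h1 : 1 < √z := by rwa [Real.lt_sqrt zero_le_one, one_pow]
  refine tendsto_lintegral_filter_of_dominated_convergence
    (fun ω => ENNReal.ofReal (z ^ τ ω / (√z - 1))) (.of_forall fun r => ?_) ?_
    (hzτ.div_const _).lintegral_lt_top.ne (.of_forall fun ω => ?_)
  · exact (measurable_of_countable fun n : ℕ => (n : ℝ≥0∞) * ENNReal.ofReal r ^ n).comp hτ
  · filter_upwards [lt_mem_nhds (zero_lt_one (α := ℝ)), gt_mem_nhds h1] with r hr0 hr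
    refine .of_forall fun ω => ?_
    rw [← ENNReal.ofReal_natCast, ← ENNReal.ofReal_pow hr0.le, ← ENNReal.ofReal_mul (by positivity)]
    exact ENNReal.ofReal_le_ofReal (natCast_mul_pow_le hz hr0.le hr.le _)
  · have : ContinuousAt (fun r : ℝ => (τ ω : ℝ≥0∞) * ENNReal.ofReal r ^ τ ω) 1 :=
      (ENNReal.continuous_const_mul (ENNReal.natCast_ne_top _)).continuousAt.comp
        (((ENNReal.continuous_pow _).comp ENNReal.continuous_ofReal).continuousAt)
    simpa using this.tendsto

lemma lintegral_natCast_ne_top {P : Measure Ω} {τ : Ω → ℕ} {z : ℝ}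
    (hz : 1 < z) (hzτ : Integrable (fun ω => z ^ τ ω) P) : ∫⁻ ω, (τ ω : ℝ≥0∞) ∂P ≠ ∞ := by
  refine ne_top_of_le_ne_top (hzτ.div_const (√z - 1)).lintegral_lt_top.ne
    (lintegral_mono fun ω => ?_)
  rw [← ENNReal.ofReal_natCast]
  refine ENNReal.ofReal_le_ofReal ?_
  simpa using natCast_mul_pow_le hz zero_le_one (Real.one_le_sqrt.2 hz.le) (τ ω)

/-! ### The upper bound for the lower limit under heavy tails -/

/-- For heavy-tailed `F` and small `α` the truncation can be chosen so that the moment of `truncExp`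
is of the prescribed order `δ`. Raising the truncation by one multiplies `1 + truncExp` by at most
`exp α`, so the first integer truncation whose moment reaches `δ` does not overshoot `2 * δ`. -/
lemma exists_truncExp_level {F : Measure ℝ} [IsProbabilityMeasure F] (hheavy : HeavyTailed F)
    {α : ℝ} (hα : 0 < α) {δ : ℝ} (hδ : 0 < δ) (hαδ : Real.exp α * (1 + δ) ≤ 1 + 2 * δ) :
    ∃ t, 0 ≤ t ∧ ENNReal.ofReal δ ≤ ∫⁻ x, truncExp α t x ∂F ∧
      ∫⁻ x, truncExp α t x ∂F ≤ ENNReal.ofReal (2 * δ) := by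
  have hlim : Tendsto (fun n : ℕ => ∫⁻ x, truncExp α n x ∂F) atTop
      (𝓝 (∫⁻ x, ENNReal.ofReal (Real.exp (α * max x 0) - 1) ∂F)) := by
    refine lintegral_tendsto_of_tendsto_of_monotone
      (fun n => (truncExp_mono hα.le).measurable.aemeasurable)
      (.of_forall fun x m n hmn => ?_) (.of_forall fun x => ?_)
    · simp only [truncExp]
      gcongr
    · refine tendsto_const_nhds.congr' ?_
      filter_upwards [tendsto_natCast_atTop_atTop.eventually_ge_atTop (max x 0)] with n hn
      rw [truncExp, min_eq_left hn]
  have htop : ∫⁻ x, ENNReal.ofReal (Real.exp (α * max x 0) - 1) ∂F = ∞ := by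
    by_contra hne
    have hle : ∞ ≤ 1 + ∫⁻ x, ENNReal.ofReal (Real.exp (α * max x 0) - 1) ∂F := by
      rw [← hheavy α hα]
      calc _ ≤ ∫⁻ x, (1 + ENNReal.ofReal (Real.exp (α * max x 0) - 1)) ∂F := by
            refine lintegral_mono fun x => ?_
            have : 1 ≤ Real.exp (α * max x 0) := Real.one_le_exp (by positivity)
            rw [← ENNReal.ofReal_one, ← ENNReal.ofReal_add zero_le_one (by linarith)]
            refine ENNReal.ofReal_le_ofReal ?_
            rw [add_sub_cancel]
            gcongr
            exact le_max_left _ _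
        _ = _ := by rw [lintegral_add_left measurable_const]; simp
    exact (ENNReal.add_lt_top.2 ⟨ENNReal.one_lt_top, lt_top_iff_ne_top.2 hne⟩).not_ge hle
  rw [htop] at hlim
  have hex : ∃ n : ℕ, ENNReal.ofReal δ ≤ ∫⁻ x, truncExp α n x ∂F :=
    ((hlim.eventually (lt_mem_nhds ENNReal.ofReal_lt_top)).mono fun n hn => hn.le).exists
  classical
  set N := Nat.find hex with hN
  have hN1 := Nat.find_spec hex
  refine ⟨N, N.cast_nonneg, hN1, ?_⟩
  have hN0 : N ≠ 0 := by
    intro h0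
    rw [← hN, h0] at hN1
    have : ∀ x, truncExp α ((0 : ℕ) : ℝ) x = 0 := fun x => by
      simp [truncExp]
    simp only [this, lintegral_zero, nonpos_iff_eq_zero, ENNReal.ofReal_eq_zero] at hN1
    linarith
  obtain ⟨m, hm⟩ := Nat.exists_eq_succ_of_ne_zero hN0
  have hm1 : ∫⁻ x, truncExp α m x ∂F < ENNReal.ofReal δ := by
    have := Nat.find_min hex (m := m) (by omega)
    exact not_le.1 this
  have key : 1 + ∫⁻ x, truncExp α N x ∂F ≤ 1 + ENNReal.ofReal (2 * δ) := by
    calc 1 + ∫⁻ x, truncExp α N x ∂F = ∫⁻ x, (1 + truncExp α N x) ∂F := by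
          rw [lintegral_add_left measurable_const]; simp
      _ ≤ ∫⁻ x, ENNReal.ofReal (Real.exp α) * (1 + truncExp α m x) ∂F := by
          refine lintegral_mono fun x => ?_
          rw [one_add_truncExp hα.le N.cast_nonneg, one_add_truncExp hα.le m.cast_nonneg,
            ← ENNReal.ofReal_mul (Real.exp_pos _).le, ← Real.exp_add]
          refine ENNReal.ofReal_le_ofReal (Real.exp_le_exp.2 ?_)
          have : min (max x 0) (N : ℝ) ≤ 1 + min (max x 0) m := by
            rw [hm, ← min_add_add_left]
            push_cast
            exact min_le_min (by linarith) (by linarith)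
          nlinarith
      _ = ENNReal.ofReal (Real.exp α) * (1 + ∫⁻ x, truncExp α m x ∂F) := by
          rw [lintegral_const_mul' _ _ ENNReal.ofReal_ne_top, lintegral_add_left measurable_const]
          simp
      _ ≤ ENNReal.ofReal (Real.exp α) * (1 + ENNReal.ofReal δ) := by gcongr
      _ ≤ _ := by
          rw [← ENNReal.ofReal_one, ← ENNReal.ofReal_add zero_le_one hδ.le,
            ← ENNReal.ofReal_add zero_le_one (by linarith),
            ← ENNReal.ofReal_mul (Real.exp_pos _).le]
          exact ENNReal.ofReal_le_ofReal hαδ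
  exact (ENNReal.add_le_add_iff_left ENNReal.one_ne_top).1 key

/-- The upper half of the first claim; it needs heavy tails and the conditional tail bound only.
If the tail ratio stayed above some `K > E τ`, the moment of `truncExp` at the random sum would be
at least `K` times its moment `d` under `F`, up to the part of the latter below `b`, which is
negligible as `α → 0`. Its upper bound is `d * E τ` to first order in `d`. -/
lemma liminf_le_lintegral {P : Measure Ω} [IsProbabilityMeasure P] {F : Measure ℝ}
    {X : ℕ → Ω → ℝ} {τ : Ω → ℕ} (hX : ∀ k, Measurable (X k)) (hF : ∀ k, P.map (X k) = F)
    (hheavy : HeavyTailed F) (hτ : Measurable τ) (hindep : IndepFun τ (fun ω k => X k ω) P)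
    {z : ℝ} (hz : 1 < z) (hzτ : Integrable (fun ω => z ^ τ ω) P) {x₀ c₀ : ℝ} (hc₀ : 0 < c₀)
    (h : CondTailBoundWith P X x₀ (ENNReal.ofReal c₀)) :
    liminf (fun x : ℝ => P {ω | x < randomSum X τ ω} / tail F x) atTop
      ≤ ∫⁻ ω, (τ ω : ℝ≥0∞) ∂P := by
  have hFin : IsProbabilityMeasure F := by
    rw [← hF 0]; exact Measure.isProbabilityMeasure_map (hX 0).aemeasurable
  by_contra! hlt
  obtain ⟨K, hmK, hK⟩ := exists_between hlt
  obtain ⟨m, hm, hmK⟩ := exists_between hmK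
  have hKtop : K ≠ ∞ := hK.ne_top
  have hmtop : m ≠ ∞ := hmK.ne_top
  obtain ⟨x₁, hx₁⟩ := eventually_atTop.1 (eventually_lt_of_lt_liminf hK)
  obtain ⟨r, hr, hr1⟩ := (((tendsto_lintegral_mul_pow hτ hz hzτ).eventually
    (gt_mem_nhds hm)).filter_mono nhdsWithin_le_nhds |>.and
      (self_mem_nhdsWithin (s := Ioi (1 : ℝ)))).exists
  set b := max (max x₀ x₁) 0 with hb
  have hb0 : 0 ≤ b := le_max_right _ _
  have hb1 : x₁ ≤ b := (le_max_right _ _).trans (le_max_left _ _)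
  have hcond := h.mono (show x₀ ≤ b from (le_max_left _ _).trans (le_max_left _ _))
  -- `δ` is the level for the moment of the truncated exponential, `α` the small exponent
  obtain ⟨δ, hδr, hδ⟩ : ∃ δ : ℝ, (1 + δ) * (1 + c₀ * (2 * δ)) < r ∧ 0 < δ := by
    have hcont : ContinuousAt (fun δ : ℝ => (1 + δ) * (1 + c₀ * (2 * δ))) 0 := by fun_prop
    exact ((hcont.eventually (gt_mem_nhds (by simpa using hr1))).filter_mono
      nhdsWithin_le_nhds |>.and (self_mem_nhdsWithin (s := Ioi (0 : ℝ)))).exists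
  have hKm : m.toReal < K.toReal := (ENNReal.toReal_lt_toReal hmtop hKtop).2 hmK
  obtain ⟨α, ⟨⟨hα1, hα2⟩, hα3⟩, hα⟩ : ∃ α : ℝ, ((Real.exp (α * b) - 1 < δ ∧
      Real.exp α * (1 + δ) < 1 + 2 * δ) ∧
      (Real.exp (α * b) - 1) * (K.toReal + m.toReal) < (K.toReal - m.toReal) * δ) ∧ 0 < α := by
    have h1 : ContinuousAt (fun α : ℝ => Real.exp (α * b) - 1) 0 := by fun_prop
    have h2 : ContinuousAt (fun α : ℝ => Real.exp α * (1 + δ)) 0 := by fun_prop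
    have h3 : ContinuousAt (fun α : ℝ => (Real.exp (α * b) - 1) * (K.toReal + m.toReal)) 0 := by
      fun_prop
    have e1 := h1.eventually (gt_mem_nhds (show Real.exp (0 * b) - 1 < δ by simpa using hδ))
    have e2 := h2.eventually (gt_mem_nhds
      (show Real.exp 0 * (1 + δ) < 1 + 2 * δ by rw [Real.exp_zero]; linarith))
    have e3 := h3.eventually (gt_mem_nhds (show (Real.exp (0 * b) - 1) * (K.toReal + m.toReal)
      < (K.toReal - m.toReal) * δ by simpa using mul_pos (sub_pos.2 hKm) hδ))
    exact (((e1.and e2).and e3).filter_mono nhdsWithin_le_nhds |>.and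
      (self_mem_nhdsWithin (s := Ioi (0 : ℝ)))).exists
  obtain ⟨t, ht, hδd, hdδ⟩ := exists_truncExp_level hheavy hα hδ hα2.le
  set d := ∫⁻ x, truncExp α t x ∂F with hd
  set η := ENNReal.ofReal (Real.exp (α * b) - 1) with hη
  have hgm : Measurable (truncExp α t) := (truncExp_mono hα.le).measurable
  -- the upper bound for the moment of the random sum
  have hup : ∫⁻ ω, truncExp α t (randomSum X τ ω) ∂P ≤ (η + d) * m := by
    have hS : ∀ n, Measurable fun y : ℕ → ℝ => ∑ k ∈ Finset.range n, y k := fun n => by fun_prop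
    calc ∫⁻ ω, truncExp α t (randomSum X τ ω) ∂P
        = ∫⁻ ω, ∫⁻ ω', truncExp α t (∑ k ∈ Finset.range (τ ω), X k ω') ∂P ∂P :=
          lintegral_comp_indep (φ := fun n y => truncExp α t (∑ k ∈ Finset.range n, y k))
            hX hτ hindep fun n => hgm.comp (hS n)
      _ ≤ ∫⁻ ω, (η + d) * (τ ω * ENNReal.ofReal r ^ τ ω) ∂P := by
          refine lintegral_mono fun ω => (lintegral_truncExp_sum_le hX hF ENNReal.ofReal_ne_top
            hcond hb0 hα.le ht hη le_rfl (τ ω)).trans ?_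
          gcongr
          calc (1 + η) * (1 + ENNReal.ofReal c₀ * d)
              ≤ (1 + ENNReal.ofReal δ) * (1 + ENNReal.ofReal c₀ * ENNReal.ofReal (2 * δ)) := by
                gcongr
                exact ENNReal.ofReal_le_ofReal hα1.le
            _ = ENNReal.ofReal ((1 + δ) * (1 + c₀ * (2 * δ))) := by
                rw [ENNReal.ofReal_mul (p := 1 + δ) (by positivity),
                  ENNReal.ofReal_add zero_le_one hδ.le,
                  ENNReal.ofReal_add zero_le_one (by positivity), ENNReal.ofReal_mul hc₀.le,
                  ENNReal.ofReal_one]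
            _ ≤ ENNReal.ofReal r := ENNReal.ofReal_le_ofReal hδr.le
      _ ≤ (η + d) * m := by
          rw [lintegral_const_mul]
          · gcongr
          · exact (measurable_of_countable fun n : ℕ => (n : ℝ≥0∞) * ENNReal.ofReal r ^ n).comp hτ
  -- the lower bound, from the tail comparison beyond `b`
  have hlow : K * ∫⁻ x, (Ioi b).indicator (truncExp α t) x ∂F
      ≤ ∫⁻ ω, truncExp α t (randomSum X τ ω) ∂P := by
    have hSm := measurable_randomSum hX hτ
    have : IsProbabilityMeasure (P.map (randomSum X τ)) :=
      Measure.isProbabilityMeasure_map hSm.aemeasurable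
    rw [← smul_eq_mul, ← lintegral_smul_measure, ← lintegral_map hgm hSm]
    refine (lintegral_le_of_tail_le (ν := P.map (randomSum X τ)) (b := b) (fun s hs => ?_)
      (monotone_indicator_Ioi (truncExp_mono hα.le) b)
      (fun x hx => indicator_of_notMem (show x ∉ Ioi b from not_lt.2 hx) _)
      (fun x => ((indicator_le_self _ (truncExp α t) x).trans_lt ENNReal.ofReal_lt_top).ne)).trans
      (lintegral_mono fun x => indicator_le_self _ _ _)
    rw [Measure.smul_apply, smul_eq_mul, Measure.map_apply hSm measurableSet_Ioi]
    exact ENNReal.mul_le_of_le_div (hx₁ s (hb1.trans hs)).le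
  have hsplit : d ≤ η + ∫⁻ x, (Ioi b).indicator (truncExp α t) x ∂F := by
    calc d ≤ ∫⁻ x, (η + (Ioi b).indicator (truncExp α t) x) ∂F := by
          refine lintegral_mono fun x => ?_
          by_cases hx : b < x
          · rw [indicator_of_mem (show x ∈ Ioi b from hx)]
            exact le_add_self
          · exact (truncExp_le hα.le hb0 (not_lt.1 hx)).trans le_self_add
      _ = _ := by rw [lintegral_add_left measurable_const]; simp
  have hfinal : K * d ≤ K * η + (η + d) * m := by
    calc K * d ≤ K * (η + ∫⁻ x, (Ioi b).indicator (truncExp α t) x ∂F) := by gcongr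
      _ ≤ _ := by rw [mul_add]; exact add_le_add le_rfl (hlow.trans hup)
  have hdtop : d ≠ ∞ := ne_top_of_le_ne_top ENNReal.ofReal_ne_top hdδ
  have hη0 : 0 ≤ Real.exp (α * b) - 1 := sub_nonneg.2 (Real.one_le_exp (by positivity))
  have hreal : K.toReal * d.toReal ≤ K.toReal * (Real.exp (α * b) - 1)
      + (Real.exp (α * b) - 1 + d.toReal) * m.toReal := by
    rw [← ENNReal.ofReal_toReal hKtop, ← ENNReal.ofReal_toReal hmtop,
      ← ENNReal.ofReal_toReal hdtop, hη, ← ENNReal.ofReal_mul ENNReal.toReal_nonneg,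
      ← ENNReal.ofReal_mul ENNReal.toReal_nonneg, ← ENNReal.ofReal_add hη0 ENNReal.toReal_nonneg,
      ← ENNReal.ofReal_mul (by positivity), ← ENNReal.ofReal_add (by positivity) (by positivity),
      ENNReal.ofReal_le_ofReal_iff (by positivity)] at hfinal
    exact hfinal
  have hδd' : δ ≤ d.toReal := (ENNReal.ofReal_le_iff_le_toReal hdtop).1 hδd
  nlinarith [mul_le_mul_of_nonneg_left hδd' (sub_pos.2 hKm).le]

/-! ### Subexponential distributions -/

lemma posPart_apply {F : Measure ℝ} {s : Set ℝ} (hs : MeasurableSet s) (h : s ⊆ Ioi 0) :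
    posPart F s = F s := by
  rw [posPart, Measure.map_apply (by fun_prop) hs]
  congr 1
  ext x
  simp only [mem_preimage]
  rcases le_total x 0 with hx | hx
  · rw [max_eq_right hx]
    exact ⟨fun h' => absurd (h h') (lt_irrefl (0 : ℝ)), fun h' => absurd (h h') (not_lt.2 hx)⟩
  · rw [max_eq_left hx]

lemma posPart_Ici {F : Measure ℝ} [IsProbabilityMeasure F] : posPart F (Ici 0) = 1 := by
  rw [posPart, Measure.map_apply (by fun_prop) measurableSet_Ici]
  convert measure_univ (μ := F)
  ext x
  simp

lemma tail_posPart {F : Measure ℝ} {x : ℝ} (hx : 0 ≤ x) : posPart F (Ioi x) = tail F x :=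
  posPart_apply measurableSet_Ioi (Ioi_subset_Ioi hx)

lemma posPart_restrict_Ioi {F : Measure ℝ} {b : ℝ} (hb : 0 ≤ b) :
    (posPart F).restrict (Ioi b) = F.restrict (Ioi b) := by
  ext s hs
  rw [Measure.restrict_apply hs, Measure.restrict_apply hs,
    posPart_apply (hs.inter measurableSet_Ioi)]
  exact inter_subset_right.trans (Ioi_subset_Ioi hb)

instance isProbabilityMeasure_posPart {F : Measure ℝ} [IsProbabilityMeasure F] :
    IsProbabilityMeasure (posPart F) :=
  Measure.isProbabilityMeasure_map (by fun_prop)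

section conv

lemma conv_real_Ioi (p : Measure ℝ) (x : ℝ) :
    (p.conv p).real (Ioi x) = (p.prod p).real {q | x < q.1 + q.2} := by
  rw [Measure.real, Measure.real, Measure.conv, Measure.map_apply (by fun_prop) measurableSet_Ioi]
  rfl

variable {p : Measure ℝ} [IsProbabilityMeasure p]

lemma real_Icc_zero (hp : p (Ici 0) = 1) {a : ℝ} (ha : 0 ≤ a) :
    p.real (Icc 0 a) = 1 - p.real (Ioi a) := by
  have h1 : p.real (Ici 0) = 1 := by simp [Measure.real, hp]
  have h2 : Ici (0 : ℝ) = Icc 0 a ∪ Ioi a := (Icc_union_Ioi_eq_Ici ha).symm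
  have hdisj : Disjoint (Icc 0 a) (Ioi a) :=
    Set.disjoint_left.2 fun y hy hy' => (not_lt.2 hy.2) (mem_Ioi.1 hy')
  rw [h2, measureReal_union hdisj measurableSet_Ioi] at h1
  linarith

lemma real_union_union_le {μ : Measure (ℝ × ℝ)} [IsFiniteMeasure μ] {A B C D : Set (ℝ × ℝ)}
    (hB : MeasurableSet B) (hC : MeasurableSet C) (hAB : Disjoint A B) (hABC : Disjoint (A ∪ B) C)
    (hD : A ∪ B ∪ C ⊆ D) : μ.real A + μ.real B + μ.real C ≤ μ.real D := by
  rw [← measureReal_union hAB hB, ← measureReal_union hABC hC]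
  exact measureReal_mono hD

/-- Three disjoint parts of the event that a sum of two nonnegative independent variables exceeds
`x`, according to whether the first one lies in `(x, ∞)`, `[0, a]` or `(a, x]`. -/
lemma tail_sub_le_conv (hp : p (Ici 0) = 1) {a x : ℝ} (ha : 0 ≤ a) (hax : a ≤ x) :
    p.real (Ioi x) + (1 - p.real (Ioi a)) * p.real (Ioi x)
      + (p.real (Ioi a) - p.real (Ioi x)) * p.real (Ioi (x - a)) ≤ (p.conv p).real (Ioi x) := by
  have h := real_union_union_le (μ := p.prod p) (A := Ioi x ×ˢ Ici 0) (B := Icc 0 a ×ˢ Ioi x)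
    (C := Ioc a x ×ˢ Ioi (x - a)) (D := {q | x < q.1 + q.2})
    (measurableSet_Icc.prod measurableSet_Ioi) (measurableSet_Ioc.prod measurableSet_Ioi)
    (Set.disjoint_left.2 fun q h1 h2 => ?_) (Set.disjoint_left.2 fun q h1 h2 => ?_) (fun q hq => ?_)
  · have h3 : p.real (Ioc a x) = p.real (Ioi a) - p.real (Ioi x) := by
      have h2 : Ioi a = Ioc a x ∪ Ioi x := (Ioc_union_Ioi_eq_Ioi hax).symm
      have hdisj : Disjoint (Ioc a x) (Ioi x) :=
        Set.disjoint_left.2 fun y hy hy' => (not_lt.2 hy.2) (mem_Ioi.1 hy')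
      rw [h2, measureReal_union hdisj measurableSet_Ioi]
      ring
    rw [measureReal_prod_prod, measureReal_prod_prod, measureReal_prod_prod, h3,
      real_Icc_zero hp ha, ← conv_real_Ioi, measureReal_def p (Ici 0), hp] at h
    simpa using h
  · have h3 := h1.1; have h4 := h2.1
    simp only [mem_Ioi, mem_Icc] at h3 h4
    linarith [h4.2]
  · have h4 := h2.1
    simp only [mem_Ioc] at h4
    rcases h1 with h1 | h1
    · have h3 := h1.1
      simp only [mem_Ioi] at h3
      linarith [h4.2]
    · have h3 := h1.1
      simp only [mem_Icc] at h3
      linarith [h4.1, h3.2]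
  · simp only [mem_union, mem_prod, mem_Ioi, mem_Ici, mem_Icc, mem_Ioc, mem_ofPred_eq] at hq ⊢
    rcases hq with (⟨h1, h2⟩ | ⟨h1, h2⟩) | ⟨h1, h2⟩
    · linarith
    · linarith [h1.1]
    · linarith [h1.1]

/-- The event that a sum of two nonnegative independent variables exceeds `x` contains, besides the
two one-big-jump parts, the part where both variables exceed `b`. -/
lemma two_mul_tail_le_conv (hp : p (Ici 0) = 1) {b x : ℝ} (hb : 0 ≤ b) (hbx : b ≤ x) :
    2 * ((1 - p.real (Ioi b)) * p.real (Ioi x))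
      + (p.prod p).real (Ioi b ×ˢ Ioi b ∩ {q | x < q.1 + q.2}) ≤ (p.conv p).real (Ioi x) := by
  have h := real_union_union_le (μ := p.prod p) (A := Ioi x ×ˢ Icc 0 b) (B := Icc 0 b ×ˢ Ioi x)
    (C := Ioi b ×ˢ Ioi b ∩ {q | x < q.1 + q.2}) (D := {q | x < q.1 + q.2})
    (measurableSet_Icc.prod measurableSet_Ioi)
    ((measurableSet_Ioi.prod measurableSet_Ioi).inter
      (measurableSet_lt measurable_const (by fun_prop)))
    (Set.disjoint_left.2 fun q h1 h2 => ?_) (Set.disjoint_left.2 fun q h1 h2 => ?_) (fun q hq => ?_)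
  · rw [measureReal_prod_prod, measureReal_prod_prod, real_Icc_zero hp hb, ← conv_real_Ioi] at h
    linarith
  · have h3 := h1.1; have h4 := h2.1
    simp only [mem_Ioi, mem_Icc] at h3 h4
    linarith [h4.2]
  · have h4 := h2.1.1; have h5 := h2.1.2
    simp only [mem_Ioi] at h4 h5
    rcases h1 with h1 | h1
    · have h3 := h1.2
      simp only [mem_Icc] at h3
      linarith [h3.2]
    · have h3 := h1.1
      simp only [mem_Icc] at h3
      linarith [h3.2]
  · simp only [mem_union, mem_prod, mem_inter_iff, mem_Ioi, mem_Icc, mem_ofPred_eq] at hq ⊢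
    rcases hq with (⟨h1, h2⟩ | ⟨h1, h2⟩) | ⟨h1, h2⟩
    · linarith [h2.1]
    · linarith [h1.1]
    · exact h2

end conv

lemma tendsto_real_Ioi_atTop (p : Measure ℝ) [IsFiniteMeasure p] :
    Tendsto (fun x => p.real (Ioi x)) atTop (𝓝 0) := by
  have h := tendsto_measure_iInter_atTop (μ := p) (s := fun x : ℝ => Ioi x)
    (fun x => measurableSet_Ioi.nullMeasurableSet) (fun x y hxy => Ioi_subset_Ioi hxy)
    ⟨0, measure_ne_top _ _⟩
  have h0 : (⋂ x : ℝ, Ioi x) = ∅ := by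
    ext y
    simp only [mem_iInter, mem_Ioi, mem_empty_iff_false, iff_false, not_forall, not_lt]
    exact ⟨y, le_rfl⟩
  rw [h0, measure_empty] at h
  exact (ENNReal.tendsto_toReal ENNReal.zero_ne_top).comp h

lemma Subexponential.tendsto_real {F : Measure ℝ} (h : Subexponential F) :
    Tendsto (fun x => ((posPart F).conv (posPart F)).real (Ioi x) / (posPart F).real (Ioi x))
      atTop (𝓝 2) := by
  have := (ENNReal.tendsto_toReal ENNReal.ofNat_ne_top).comp h
  simpa [Function.comp_def, ENNReal.toReal_div, tail, Measure.real] using this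

lemma real_Ioi_posPart_pos {F : Measure ℝ} [IsProbabilityMeasure F] (hheavy : HeavyTailed F)
    {x : ℝ} (hx : 0 ≤ x) : 0 < (posPart F).real (Ioi x) := by
  rw [measureReal_def, tail_posPart hx]
  exact ENNReal.toReal_pos (tail_ne_zero hheavy x) (measure_ne_top _ _)

/-- Sandwich `1 ≤ T (x - a) / T x ≤ (N x / T x - 2 + T a) / (T a - T x)`, where `T` is the tail of
`F⁺` and `N` that of its convolution square; the right-hand side tends to `1` as `N / T → 2`. -/
lemma Subexponential.tendsto_sub_div {F : Measure ℝ} [IsProbabilityMeasure F]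
    (hheavy : HeavyTailed F) (h : Subexponential F) {a : ℝ} (ha : 0 ≤ a) :
    Tendsto (fun x => (posPart F).real (Ioi (x - a)) / (posPart F).real (Ioi x)) atTop (𝓝 1) := by
  set p := posPart F with hp
  have hTa : 0 < p.real (Ioi a) := real_Ioi_posPart_pos hheavy ha
  have hT0 := tendsto_real_Ioi_atTop p
  have hup : Tendsto (fun x => ((p.conv p).real (Ioi x) / p.real (Ioi x) - 2 + p.real (Ioi a))
      / (p.real (Ioi a) - p.real (Ioi x))) atTop (𝓝 1) := by
    have := ((h.tendsto_real.sub_const 2).add_const (p.real (Ioi a))).div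
      (tendsto_const_nhds.sub hT0) (show p.real (Ioi a) - 0 ≠ 0 by simpa using hTa.ne')
    rw [sub_self, zero_add, sub_zero, div_self hTa.ne'] at this
    exact this
  refine tendsto_of_tendsto_of_tendsto_of_le_of_le' tendsto_const_nhds hup ?_ ?_
  · filter_upwards [eventually_ge_atTop 0] with x hx
    rw [le_div_iff₀ (real_Ioi_posPart_pos hheavy hx), one_mul]
    exact measureReal_mono (Ioi_subset_Ioi (by linarith))
  · filter_upwards [eventually_ge_atTop a, hT0.eventually (gt_mem_nhds hTa)] with x hxa hxT
    have hTx : 0 < p.real (Ioi x) := real_Ioi_posPart_pos hheavy (ha.trans hxa)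
    have hmain := tail_sub_le_conv (p := p) posPart_Ici ha hxa
    rw [le_div_iff₀ (sub_pos.2 hxT), div_mul_eq_mul_div, div_le_iff₀ hTx]
    have : ((p.conv p).real (Ioi x) / p.real (Ioi x) - 2 + p.real (Ioi a)) * p.real (Ioi x)
        = (p.conv p).real (Ioi x) - 2 * p.real (Ioi x) + p.real (Ioi a) * p.real (Ioi x) := by
      field_simp
    rw [this]
    linarith

lemma Subexponential.longTailed {F : Measure ℝ} [IsProbabilityMeasure F]
    (hheavy : HeavyTailed F) (h : Subexponential F) : LongTailed F := by
  intro y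
  set p := posPart F with hp
  have hreal : Tendsto (fun x => p.real (Ioi (x + y)) / p.real (Ioi x)) atTop (𝓝 1) := by
    rcases le_total y 0 with hy | hy
    · simpa using h.tendsto_sub_div hheavy (a := -y) (by linarith)
    · have h1 := ((h.tendsto_sub_div hheavy hy).comp (tendsto_atTop_add_const_right atTop y
        tendsto_id)).inv₀ one_ne_zero
      simpa [Function.comp_def] using h1
  have := ENNReal.tendsto_ofReal hreal
  rw [ENNReal.ofReal_one] at this
  refine this.congr' ?_
  filter_upwards [eventually_ge_atTop 0, eventually_ge_atTop (-y)] with x hx hxy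
  rw [ENNReal.ofReal_div_of_pos (real_Ioi_posPart_pos hheavy hx), ofReal_measureReal,
    ofReal_measureReal, hp, tail_posPart hx, tail_posPart (by linarith)]

/-- For subexponential `F`, two independent variables that both exceed a high level `b` seldom have
their sum beyond `x`, compared with one variable beyond both `x` and `b`, uniformly in all real
`x`. -/
lemma Subexponential.exists_forall_le {F : Measure ℝ} [IsProbabilityMeasure F]
    (hheavy : HeavyTailed F) (h : Subexponential F) {δ : ℝ} (hδ : 0 < δ) (b₀ : ℝ) :
    ∃ b, b₀ ≤ b ∧ 0 ≤ b ∧ ∀ x, ∫⁻ y, F.restrict (Ioi b) (Ioi (x - y)) ∂(F.restrict (Ioi b))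
      ≤ ENNReal.ofReal δ * F.restrict (Ioi b) (Ioi x) := by
  set p := posPart F with hp
  have hT0 := tendsto_real_Ioi_atTop p
  obtain ⟨b₁, hb₁, hb₁0⟩ := ((hT0.eventually (gt_mem_nhds (half_pos hδ))).and
    (eventually_ge_atTop 0)).exists
  have hev : ∀ᶠ x in atTop, (p.conv p).real (Ioi x) / p.real (Ioi x)
      < 2 + (δ - 2 * p.real (Ioi b₁)) :=
    h.tendsto_real.eventually (gt_mem_nhds (by linarith))
  obtain ⟨x₁, hx₁⟩ := eventually_atTop.1 hev
  -- the bound beyond `x₁`, for the joint exceedance of the fixed level `b₁`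
  have hlarge : ∀ x, x₁ ≤ x → b₁ ≤ x →
      p.prod p (Ioi b₁ ×ˢ Ioi b₁ ∩ {q | x < q.1 + q.2}) ≤ ENNReal.ofReal δ * p (Ioi x) := by
    intro x hx hbx
    have hTx : 0 < p.real (Ioi x) := real_Ioi_posPart_pos hheavy (hb₁0.trans hbx)
    have h1 := hx₁ x hx
    rw [div_lt_iff₀ hTx] at h1
    have h2 := two_mul_tail_le_conv (p := p) posPart_Ici hb₁0 hbx
    rw [← ofReal_measureReal (μ := p), ← ENNReal.ofReal_mul hδ.le, ← ofReal_measureReal]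
    exact ENNReal.ofReal_le_ofReal (by linarith)
  set b := max (max b₀ b₁) (max x₁ 0) with hb
  have hbb₁ : b₁ ≤ b := (le_max_right _ _).trans (le_max_left _ _)
  have hbx₁ : x₁ ≤ b := (le_max_left _ _).trans (le_max_right _ _)
  have hb0 : 0 ≤ b := (le_max_right _ _).trans (le_max_right _ _)
  refine ⟨b, (le_max_left _ _).trans (le_max_left _ _), hb0, fun x => ?_⟩
  rw [← posPart_restrict_Ioi hb0, ← hp]
  have hset : ∀ x : ℝ, MeasurableSet {q : ℝ × ℝ | x < q.1 + q.2} := fun x =>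
    measurableSet_lt measurable_const (by fun_prop)
  have hprod : ∫⁻ y, p.restrict (Ioi b) (Ioi (x - y)) ∂(p.restrict (Ioi b))
      = p.prod p (Ioi b ×ˢ Ioi b ∩ {q | x < q.1 + q.2}) := by
    rw [inter_comm, ← Measure.restrict_apply (hset x), ← Measure.prod_restrict,
      Measure.prod_apply (hset x)]
    refine lintegral_congr fun y => ?_
    congr 1
    ext t
    simp [sub_lt_iff_lt_add']
  rw [hprod, Measure.restrict_apply measurableSet_Ioi]
  -- below `2 * b` the joint exceedance of `b` is the same event as at `2 * b`
  calc p.prod p (Ioi b ×ˢ Ioi b ∩ {q | x < q.1 + q.2})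
      ≤ p.prod p (Ioi b₁ ×ˢ Ioi b₁ ∩ {q | max x (2 * b) < q.1 + q.2}) := by
        refine measure_mono fun q hq => ?_
        have h1 : b < q.1 := hq.1.1
        have h2 : b < q.2 := hq.1.2
        exact ⟨⟨hbb₁.trans_lt h1, hbb₁.trans_lt h2⟩,
          max_lt hq.2 (show 2 * b < q.1 + q.2 by linarith)⟩
    _ ≤ ENNReal.ofReal δ * p (Ioi (max x (2 * b))) :=
        hlarge _ (le_max_of_le_right (by linarith)) (le_max_of_le_right (by linarith))
    _ ≤ _ := by
        gcongr
        exact fun t ht => ⟨(le_max_left x (2 * b)).trans_lt (mem_Ioi.1 ht),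
          ((by linarith : b ≤ 2 * b).trans (le_max_right x _)).trans_lt (mem_Ioi.1 ht)⟩

lemma LongTailed.tendsto_sub {F : Measure ℝ} (h : LongTailed F) (a : ℝ) :
    Tendsto (fun x => tail F (x - a) / tail F x) atTop (𝓝 1) := by
  simpa [sub_eq_add_neg] using h (-a)

/-- Long tails are insensitive to shifts growing linearly in `n`, up to an exponential factor of
rate arbitrarily close to `1`. -/
lemma LongTailed.exists_forall_tail_sub_le {F : Measure ℝ} [IsProbabilityMeasure F]
    (hheavy : HeavyTailed F) (h : LongTailed F) (b : ℝ) {η : ℝ≥0∞} (hη : 0 < η) :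
    ∃ C : ℝ≥0∞, C ≠ ∞ ∧ ∀ (n : ℕ) (x : ℝ), tail F (x - n * b) ≤ C * (1 + η) ^ n * tail F x := by
  obtain ⟨A, hA⟩ := eventually_atTop.1 ((h.tendsto_sub b).eventually
    (gt_mem_nhds (show (1 : ℝ≥0∞) < 1 + η from
      ENNReal.lt_add_right ENNReal.one_ne_top hη.ne')))
  refine ⟨(tail F A)⁻¹, ENNReal.inv_ne_top.2 (tail_ne_zero hheavy A), fun n => ?_⟩
  have hsmall : ∀ (n : ℕ) (x : ℝ), x ≤ A →
      tail F (x - n * b) ≤ (tail F A)⁻¹ * (1 + η) ^ n * tail F x := fun n x hx => by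
    calc tail F (x - n * b) ≤ 1 := prob_le_one
      _ = (tail F A)⁻¹ * 1 * tail F A := by
        rw [mul_one, ENNReal.inv_mul_cancel (tail_ne_zero hheavy A) (measure_ne_top _ _)]
      _ ≤ (tail F A)⁻¹ * (1 + η) ^ n * tail F x := by
        gcongr
        · exact one_le_pow₀ le_self_add
        · exact measure_mono (Ioi_subset_Ioi hx)
  induction n with
  | zero =>
    intro x
    rw [pow_zero, mul_one, Nat.cast_zero, zero_mul, sub_zero]
    exact le_mul_of_one_le_left' (ENNReal.one_le_inv.2 prob_le_one)
  | succ n ih =>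
    intro x
    rcases le_total x A with hx | hx
    · exact hsmall _ x hx
    · have h1 : tail F (x - b) ≤ (1 + η) * tail F x :=
        (ENNReal.div_le_iff_le_mul (.inl (tail_ne_zero hheavy x))
          (.inl (measure_ne_top _ _))).1 (hA x hx).le
      calc tail F (x - (n + 1 : ℕ) * b) = tail F (x - b - n * b) := by push_cast; ring_nf
        _ ≤ (tail F A)⁻¹ * (1 + η) ^ n * tail F (x - b) := ih _
        _ ≤ (tail F A)⁻¹ * (1 + η) ^ n * ((1 + η) * tail F x) := by gcongr
        _ = _ := by ring

/-! ### Tails of sums of subexponential terms -/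

/-- Union bound over the set `J` of the indices of the terms that exceed `b`: the other terms add
up to at most `n * b`, and `J` is nonempty because `n * b ≤ x`. -/
lemma measure_sum_range_gt_le {P : Measure Ω} [IsFiniteMeasure P] {F : Measure ℝ}
    {X : ℕ → Ω → ℝ} {b : ℝ} {c δ : ℝ≥0∞} (hX : ∀ k, Measurable (X k)) (hF : ∀ k, P.map (X k) = F)
    (hc : c ≠ ∞) (h : CondTailBoundWith P X b c) (hb : 0 ≤ b)
    (hG : ∀ x, ∫⁻ y, F.restrict (Ioi b) (Ioi (x - y)) ∂(F.restrict (Ioi b))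
      ≤ δ * F.restrict (Ioi b) (Ioi x)) {n : ℕ} {x : ℝ} (hx : n * b ≤ x) :
    P {ω | x < ∑ k ∈ Finset.range n, X k ω} ≤ n * (1 + c * δ) ^ n * tail F (x - n * b) := by
  classical
  have hsub : {ω | x < ∑ k ∈ Finset.range n, X k ω} ⊆
      ⋃ J ∈ (Finset.range n).powerset.filter Finset.Nonempty,
        {ω | (∀ j ∈ J, b < X j ω) ∧ x - n * b < ∑ j ∈ J, X j ω} := by
    intro ω hω
    have hω' : x < ∑ k ∈ Finset.range n, X k ω := hω
    set J := (Finset.range n).filter fun j => b < X j ω with hJ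
    have hsum : ∑ k ∈ Finset.range n, X k ω ≤ ∑ j ∈ J, X j ω + n * b := by
      rw [← Finset.sum_filter_add_sum_filter_not (Finset.range n) fun j => b < X j ω]
      refine add_le_add le_rfl ?_
      calc _ ≤ ∑ k ∈ (Finset.range n).filter (fun j => ¬ b < X j ω), b :=
            Finset.sum_le_sum fun k hk => not_lt.1 (Finset.mem_filter.1 hk).2
        _ ≤ ∑ k ∈ Finset.range n, b :=
            Finset.sum_le_sum_of_subset_of_nonneg (Finset.filter_subset _ _) fun _ _ _ => hb
        _ = n * b := by simp
    have hJne : J.Nonempty := by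
      rw [Finset.nonempty_iff_ne_empty]
      intro h0
      rw [h0, Finset.sum_empty] at hsum
      linarith
    refine mem_iUnion₂.2 ⟨J, Finset.mem_filter.2
      ⟨Finset.mem_powerset.2 (Finset.filter_subset _ _), hJne⟩,
      fun j hj => (Finset.mem_filter.1 hj).2, by linarith⟩
  calc P {ω | x < ∑ k ∈ Finset.range n, X k ω}
      ≤ ∑ J ∈ (Finset.range n).powerset.filter Finset.Nonempty,
          P {ω | (∀ j ∈ J, b < X j ω) ∧ x - n * b < ∑ j ∈ J, X j ω} :=
        (measure_mono hsub).trans (measure_biUnion_finset_le _ _)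
    _ ≤ ∑ J ∈ (Finset.range n).powerset.filter Finset.Nonempty,
          (c * δ) ^ (J.card - 1) * tail F (x - n * b) := by
        refine Finset.sum_le_sum fun J hJ => ?_
        refine (measure_sum_gt_le hX hF hc h hG (Finset.mem_filter.1 hJ).2 _).trans ?_
        gcongr
        exact Measure.restrict_apply_le _ _
    _ = (∑ J ∈ (Finset.range n).powerset, if J.Nonempty then (c * δ) ^ (J.card - 1) else 0)
          * tail F (x - n * b) := by
        rw [← Finset.sum_mul, Finset.sum_filter]
    _ ≤ _ := by
        gcongr
        simpa using sum_powerset_pow_card_sub_one_le (Finset.range n) (c * δ)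

lemma eventually_measure_sum_gt_div_tail_lt {P : Measure Ω} [IsProbabilityMeasure P]
    {F : Measure ℝ} {X : ℕ → Ω → ℝ} (hX : ∀ k, Measurable (X k)) (hF : ∀ k, P.map (X k) = F)
    (hheavy : HeavyTailed F) (hsub : Subexponential F) {x₀ c₀ : ℝ}
    (h : CondTailBoundWith P X x₀ (ENNReal.ofReal c₀)) (n : ℕ) {a : ℝ≥0∞} (ha : n < a) :
    ∀ᶠ x in atTop, P {ω | x < ∑ k ∈ Finset.range n, X k ω} / tail F x < a := by
  have hFin : IsProbabilityMeasure F := by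
    rw [← hF 0]; exact Measure.isProbabilityMeasure_map (hX 0).aemeasurable
  obtain ⟨δ, hδa, hδ⟩ : ∃ δ : ℝ,
      n * (1 + ENNReal.ofReal c₀ * ENNReal.ofReal δ) ^ n < a ∧ 0 < δ := by
    have hcont : Continuous fun δ : ℝ => n * (1 + ENNReal.ofReal c₀ * ENNReal.ofReal δ) ^ n := by
      refine (ENNReal.continuous_const_mul (ENNReal.natCast_ne_top n)).comp
        ((ENNReal.continuous_pow n).comp (continuous_const.add
          ((ENNReal.continuous_const_mul ENNReal.ofReal_ne_top).comp ENNReal.continuous_ofReal)))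
    exact ((hcont.continuousAt.eventually (gt_mem_nhds (show
      n * (1 + ENNReal.ofReal c₀ * ENNReal.ofReal 0) ^ n < a by simpa using ha))).filter_mono
      nhdsWithin_le_nhds |>.and (self_mem_nhdsWithin (s := Ioi (0 : ℝ)))).exists
  obtain ⟨b, hb₀, hb, hG⟩ := hsub.exists_forall_le hheavy hδ x₀
  have hlim := ENNReal.Tendsto.const_mul (a := n * (1 + ENNReal.ofReal c₀ * ENNReal.ofReal δ) ^ n)
    ((hsub.longTailed hheavy).tendsto_sub (n * b)) (.inl one_ne_zero)
  rw [mul_one] at hlim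
  filter_upwards [hlim.eventually (gt_mem_nhds hδa), eventually_ge_atTop (n * b)] with x hx hxb
  refine lt_of_le_of_lt ?_ hx
  rw [← mul_div_assoc]
  gcongr
  exact measure_sum_range_gt_le hX hF ENNReal.ofReal_ne_top (h.mono hb₀) hb hG hxb

/-- Kesten-type bound for the full sums, uniform in `n` and `x`, with an exponential rate as close
to `1` as desired. One factor `1 + ε` pays for the choice of the large terms, the other for the
shift of the tail by `n * b`. -/
lemma exists_forall_measure_sum_gt_le {P : Measure Ω} [IsProbabilityMeasure P]
    {F : Measure ℝ} {X : ℕ → Ω → ℝ} (hX : ∀ k, Measurable (X k)) (hF : ∀ k, P.map (X k) = F)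
    (hheavy : HeavyTailed F) (hsub : Subexponential F) {x₀ c₀ : ℝ} (hc₀ : 0 < c₀)
    (h : CondTailBoundWith P X x₀ (ENNReal.ofReal c₀)) {ε : ℝ} (hε : 0 < ε) :
    ∃ C : ℝ≥0∞, C ≠ ∞ ∧ ∀ (n : ℕ) (x : ℝ), 0 ≤ x →
      P {ω | x < ∑ k ∈ Finset.range n, X k ω}
        ≤ C * (n * ENNReal.ofReal ((1 + ε) ^ 2) ^ n) * tail F x := by
  have hFin : IsProbabilityMeasure F := by
    rw [← hF 0]; exact Measure.isProbabilityMeasure_map (hX 0).aemeasurable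
  obtain ⟨b, hb₀, hb, hG⟩ := hsub.exists_forall_le hheavy (div_pos hε hc₀) x₀
  have hcδ : ENNReal.ofReal c₀ * ENNReal.ofReal (ε / c₀) = ENNReal.ofReal ε := by
    rw [← ENNReal.ofReal_mul hc₀.le, mul_div_cancel₀ _ hc₀.ne']
  obtain ⟨C, hC, hCle⟩ := (hsub.longTailed hheavy).exists_forall_tail_sub_le hheavy b
    (ENNReal.ofReal_pos.2 hε)
  have hr : ENNReal.ofReal ((1 + ε) ^ 2) = (1 + ENNReal.ofReal ε) * (1 + ENNReal.ofReal ε) := by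
    rw [← ENNReal.ofReal_one, ← ENNReal.ofReal_add zero_le_one hε.le,
      ← ENNReal.ofReal_mul (by positivity), sq]
  have hr1 : ∀ n : ℕ, 1 ≤ (1 + ENNReal.ofReal ε) ^ n := fun n => one_le_pow₀ le_self_add
  have h0 : tail F 0 ≠ 0 := tail_ne_zero hheavy 0
  refine ⟨(tail F 0)⁻¹ * C, ENNReal.mul_ne_top (ENNReal.inv_ne_top.2 h0) hC, fun n x hx => ?_⟩
  have h0' : 1 ≤ (tail F 0)⁻¹ := ENNReal.one_le_inv.2 prob_le_one
  rw [hr, mul_pow]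
  rcases le_or_gt (n * b) x with hxb | hxb
  · calc P {ω | x < ∑ k ∈ Finset.range n, X k ω}
        ≤ n * (1 + ENNReal.ofReal c₀ * ENNReal.ofReal (ε / c₀)) ^ n * tail F (x - n * b) :=
          measure_sum_range_gt_le hX hF ENNReal.ofReal_ne_top (h.mono hb₀) hb hG hxb
      _ ≤ n * (1 + ENNReal.ofReal ε) ^ n * (C * (1 + ENNReal.ofReal ε) ^ n * tail F x) := by
          rw [hcδ]
          gcongr
          exact hCle n x
      _ = 1 * C * (n * ((1 + ENNReal.ofReal ε) ^ n * (1 + ENNReal.ofReal ε) ^ n)) * tail F x := by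
          ring
      _ ≤ _ := by gcongr
  · have hn : (1 : ℝ≥0∞) ≤ n := by
      have : n ≠ 0 := by
        rintro rfl
        simp at hxb
        linarith
      exact_mod_cast Nat.one_le_iff_ne_zero.2 this
    calc P {ω | x < ∑ k ∈ Finset.range n, X k ω} ≤ 1 := prob_le_one
      _ = (tail F 0)⁻¹ * tail F 0 := (ENNReal.inv_mul_cancel h0 (measure_ne_top _ _)).symm
      _ ≤ (tail F 0)⁻¹ * tail F (x - n * b) := by
          gcongr
          exact measure_mono (Ioi_subset_Ioi (by linarith))
      _ ≤ (tail F 0)⁻¹ * (C * (1 + ENNReal.ofReal ε) ^ n * tail F x) := by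
          gcongr
          exact hCle n x
      _ = (tail F 0)⁻¹ * C * (1 * (1 * (1 + ENNReal.ofReal ε) ^ n)) * tail F x := by ring
      _ ≤ _ := by
          gcongr
          exact hr1 n

lemma tendsto_randomSum {P : Measure Ω} [IsProbabilityMeasure P] {F : Measure ℝ}
    {X : ℕ → Ω → ℝ} {τ : Ω → ℕ} (hX : ∀ k, Measurable (X k)) (hF : ∀ k, P.map (X k) = F)
    (hheavy : HeavyTailed F) (hsub : Subexponential F) (hind : PairwiseAsympIndep P X)
    (hτ : Measurable τ) (hindep : IndepFun τ (fun ω k => X k ω) P)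
    {z : ℝ} (hz : 1 < z) (hzτ : Integrable (fun ω => z ^ τ ω) P) {x₀ c₀ : ℝ} (hc₀ : 0 < c₀)
    (h : CondTailBoundWith P X x₀ (ENNReal.ofReal c₀)) :
    Tendsto (fun x : ℝ => P {ω | x < randomSum X τ ω} / tail F x) atTop
      (𝓝 (∫⁻ ω, (τ ω : ℝ≥0∞) ∂P)) := by
  have hFin : IsProbabilityMeasure F := by
    rw [← hF 0]; exact Measure.isProbabilityMeasure_map (hX 0).aemeasurable
  have hz1 : 1 < √(√z) := by
    rw [Real.lt_sqrt zero_le_one, one_pow, Real.lt_sqrt zero_le_one, one_pow]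
    exact hz
  obtain ⟨C, hC, hCle⟩ := exists_forall_measure_sum_gt_le hX hF hheavy hsub hc₀ h
    (sub_pos.2 hz1)
  have hr : (1 + (√(√z) - 1)) ^ 2 = √z := by
    rw [add_sub_cancel, Real.sq_sqrt (Real.sqrt_nonneg _)]
  rw [hr] at hCle
  have heq : ∀ x, P {ω | x < randomSum X τ ω} / tail F x
      = ∫⁻ ω, P {ω' | x < ∑ k ∈ Finset.range (τ ω), X k ω'} / tail F x ∂P := fun x => by
    simp_rw [ENNReal.div_eq_inv_mul]
    rw [measure_randomSum_gt hX hτ hindep, lintegral_const_mul]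
    exact (measurable_of_countable fun n : ℕ =>
        P {ω' | x < ∑ k ∈ Finset.range n, X k ω'}).comp hτ
  simp_rw [heq]
  refine tendsto_lintegral_filter_of_dominated_convergence
    (fun ω => C * (τ ω * ENNReal.ofReal (√z) ^ τ ω)) (.of_forall fun x => ?_) ?_ ?_
    (.of_forall fun ω => ?_)
  · exact (measurable_of_countable fun n : ℕ =>
      P {ω' | x < ∑ k ∈ Finset.range n, X k ω'} / tail F x).comp hτ
  · filter_upwards [eventually_ge_atTop 0] with x hx
    exact .of_forall fun ω => ENNReal.div_le_of_le_mul (hCle _ x hx)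
  · rw [lintegral_const_mul' _ _ hC]
    refine ENNReal.mul_ne_top hC (ne_top_of_le_ne_top
      (hzτ.div_const (√z - 1)).lintegral_lt_top.ne (lintegral_mono fun ω => ?_))
    rw [← ENNReal.ofReal_natCast, ← ENNReal.ofReal_pow (Real.sqrt_nonneg _),
      ← ENNReal.ofReal_mul (by positivity)]
    exact ENNReal.ofReal_le_ofReal (natCast_mul_pow_le hz (Real.sqrt_nonneg _) le_rfl _)
  · exact tendsto_order.2 ⟨fun a ha => eventually_lt_measure_sum_gt_div_tail hX hF
      (hsub.longTailed hheavy) hind (τ ω) ha, fun a ha =>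
        eventually_measure_sum_gt_div_tail_lt hX hF hheavy hsub h (τ ω) ha⟩

end RandomSum

theorem theorem4p1 {Ω : Type*} [MeasurableSpace Ω] (P : Measure Ω) [IsProbabilityMeasure P]
    (F : Measure ℝ) (X : ℕ → Ω → ℝ) (τ : Ω → ℕ)
    (hX : ∀ k, Measurable (X k)) (hF : ∀ k, P.map (X k) = F)
    (hheavy : RandomSum.HeavyTailed F)
    (hτ : Measurable τ) (hindep : IndepFun τ (fun ω k => X k ω) P)
    (z : ℝ) (hz : 1 < z) (hzτ : Integrable (fun ω => z ^ τ ω) P)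
    (hH2 : RandomSum.PairwiseAsympIndep P X)
    (hH3 : RandomSum.CondTailBound P X) :
    (RandomSum.LongTailed F →
      liminf (fun x : ℝ => P {ω | x < RandomSum.randomSum X τ ω} / RandomSum.tail F x) atTop
        = ∫⁻ ω, (τ ω : ℝ≥0∞) ∂P) ∧
    (RandomSum.Subexponential F →
      Tendsto (fun x : ℝ => P {ω | x < RandomSum.randomSum X τ ω} / RandomSum.tail F x) atTop
        (𝓝 (∫⁻ ω, (τ ω : ℝ≥0∞) ∂P))) := by
  obtain ⟨x₀, c₀, -, hc₀, h⟩ := hH3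
  refine ⟨fun hlong => le_antisymm ?_ ?_, fun hsub => ?_⟩
  · exact RandomSum.liminf_le_lintegral hX hF hheavy hτ hindep hz hzτ hc₀ h
  · exact RandomSum.lintegral_le_liminf hX hF hlong hH2 hτ hindep
      (RandomSum.lintegral_natCast_ne_top hz hzτ)
  · exact RandomSum.tendsto_randomSum hX hF hheavy hsub hH2 hτ hindep hz hzτ hc₀ h
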